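/- **Setting.** A process theory is a symmetric monoidal category, and a diagram-preserving (DP) map is a strict symmetric monoidal functor. $\mathrm{SubStoch}$ has sets as systems and, as processes $X\to Y$, the maps assigning to each $x\in X$ a finitely supported subprobability distribution on $Y$; such a map is stochastic if all its values are normalised. $\mathrm{Func}$ is the process theory of finite sets and functions. $\mathrm{Proc}$ is the process theory freely generated by primitive systems, some of which are classical (with a given set of states), and primitive procedures; the classical systems are the composites of primitive classical ones. For a process theory $\mathcal C$ with a class of classical systems (each with a set of states), the causal-inferential (CI) theory over $\mathcal C$ is generated by $\mathcal C$ and $\mathrm{SubStoch}$ (so that its systems are composites of a causal system $A$ and an inferential system $X$), by the processes $K_{A,B}$ (with inputs $A$ and the inferential system $\mathcal C(A,B)$, and output $B$; it feeds knowledge about a process $A\to B$ into that process), by $\mathrm{learn}_A$ for classical $A$ (with input $A$ and outputs $A$ and the set of states of $A$), and by $\mathrm{ignore}_A$ (with input $A$ and no output), modulo the following rewrite rules: a process $t$ of $\mathcal C$ equals $K$ applied to the certain knowledge $[t]$; $K$'s composed in sequence or in parallel equal the $K$ of the composite, applied to the knowledge pushed forward along composition; learning and then discarding what was learned is doing nothing,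 learning twice is learning once and copying, and learning about a composite is learning about its parts; ignoring a composite is ignoring its parts, and ignoring the trivial system is doing nothing; and $K_{A,B}$ followed by $\mathrm{ignore}_B$ equals discarding the knowledge and applying $\mathrm{ignore}_A$. $\mathrm{P\text{-}S}$ is the CI theory over $\mathrm{Proc}$. $\mathrm{F\text{-}S}$ is the CI theory over $\mathrm{Func}$, where every system is classical with itself as set of states, with the further rule that $K_{\Lambda,\Lambda'}$ followed by learning about $\Lambda'$ equals copying the knowledge about the function $f$, learning about the input $\lambda\in\Lambda$, applying $K_{\Lambda,\Lambda'}$ to one copy of the knowledge of $f$, and updating the other copy and what was learned along $(f,\lambda)\mapsto f(\lambda)$. A prediction map of a CI theory is a DP map to $\mathrm{SubStoch}$, defined on the processes without causal inputs and outputs, that is a left inverse of the inclusion of $\mathrm{SubStoch}$. Let $\mathbf p$ be a prediction map of $\mathrm{P\text{-}S}$ and $\mathbf p^*$ one of $\mathrm{F\text{-}S}$. Two processes $D,E:P\to Q$ of $\mathrm{F\text{-}S}$ are inferentially equivalent, $D\sim_{\mathbf p^*}E$, if $\mathbf p^*\big(y\circ(D\otimes 1_W)\circ x\big)=\mathbf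 p^*\big(y\circ(E\otimes 1_W)\circ x\big)$ for all systems $W$, all inferential systems $X,Y$ and all processes $x:X\to P\otimes W$ and $y:Q\otimes W\to Y$. A classical realist representation of $(\mathrm{P\text{-}S},\mathbf p)$ is a DP map $\xi:\mathrm{P\text{-}S}\to\mathrm{F\text{-}S}$, mapping each causal system $A$ to a finite set $\Lambda_A$ and each inferential system to itself, that preserves predictions, $\mathbf p^*\circ\xi=\mathbf p$, and ignorability, $\xi(\mathrm{ignore}_A)=\mathrm{ignore}_{\Lambda_A}$. **Theorem.** Let $\xi$ be a classical realist representation of $(\mathrm{P\text{-}S},\mathbf p)$. Then there are stochastic maps $\Xi_A^B:\mathrm{Proc}(A,B)\to\mathrm{Func}(\Lambda_A,\Lambda_B)$, for all systems $A,B$ of $\mathrm{Proc}$, which commute with sequential and parallel composition and map certain knowledge of wiring (identities, associators, unitors and swaps) to certain knowledge of the same wiring in $\mathrm{Func}$, such that $$\xi(K_{A,B})\ \sim_{\mathbf p^*}\ K_{\Lambda_A,\Lambda_B}\circ\big(1_{\Lambda_A}\otimes\Xi_A^B\big)\qquad\text{for all }A,B.$$ Moreover, there is a classical realist representation $\xi'$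 of $(\mathrm{P\text{-}S},\mathbf p)$, with the same sets $\Lambda_A$, that is of this natural form, $\xi'(K_{A,B})=K_{\Lambda_A,\Lambda_B}\circ(1_{\Lambda_A}\otimes\Xi_A^B)$ for all $A,B$, and that is inferentially equivalent to $\xi$: $\xi(D)\sim_{\mathbf p^*}\xi'(D)$ for every process $D$ of $\mathrm{P\text{-}S}$. -/

import Mathlib

open CategoryTheory MonoidalCategory
open scoped NNReal

universe u w

noncomputable section

/-! ## The inferential theory: substochastic maps

Systems are arbitrary sets (types); a process from `X` to `Y` assigns to every `x : X` a finitely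
supported subnormalised distribution over `Y` (Kleisli maps of the subdistribution monad). -/

/-- A finitely supported subprobability distribution on `X`. -/
structure SubDist (X : Type u) where
  weight : X →₀ ℝ≥0
  sum_le_one : weight.sum (fun _ r => r) ≤ 1

namespace SubDist

variable {X Y Z : Type u}

@[ext]
theorem ext {d e : SubDist X} (h : d.weight = e.weight) : d = e := by
  cases d; cases e; congr

/-- The total weight of a subdistribution. -/
def mass (d : SubDist X) : ℝ≥0 := d.weight.sum fun _ r => r

/-- The point distribution `[x]`. -/
def pure (x : X) : SubDist X where
  weight := Finsupp.single x 1
  sum_le_one := by simp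

theorem sum_linear (f : X →₀ ℝ≥0) (g : X → Y →₀ ℝ≥0) :
    (f.sum fun x r => r • g x).sum (fun _ r => r)
      = f.sum fun x r => r * (g x).sum (fun _ r => r) := by
  rw [Finsupp.sum_sum_index (by simp) (by simp)]
  refine Finsupp.sum_congr fun x _ => ?_
  rw [Finsupp.sum_smul_index (by simp), Finsupp.mul_sum]

/-- Averaging a family of subdistributions over a subdistribution. -/
def bind (d : SubDist X) (k : X → SubDist Y) : SubDist Y where
  weight := d.weight.sum fun x r => r • (k x).weight
  sum_le_one := by
    rw [sum_linear]
    refine le_trans (Finset.sum_le_sum fun x _ => ?_) d.sum_le_one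
    exact mul_le_of_le_one_right zero_le (k x).sum_le_one

theorem pure_bind (x : X) (k : X → SubDist Y) : (pure x).bind k = k x := by
  ext1
  simp [pure, bind]

end SubDist

/-- A substochastic map from `X` to `Y`. -/
def SubStoch (X Y : Type u) : Type u := X → SubDist Y

namespace SubStoch

variable {X Y Z X' Y' Z' : Type u}

/-- A stochastic map: every value is a normalised distribution. -/
def IsStochastic (s : SubStoch X Y) : Prop := ∀ x, (s x).mass = 1

/-- The deterministic map given by a function. -/
def det (f : X → Y) : SubStoch X Y := fun x => SubDist.pure (f x)

/-- The identity map. -/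
def id (X : Type u) : SubStoch X X := det fun x => x

/-- Sequential composition, in diagrammatic order: first `s`, then `t`. -/
def comp (s : SubStoch X Y) (t : SubStoch Y Z) : SubStoch X Z := fun x => (s x).bind t

/-- Parallel composition. -/
def tensor (s : SubStoch X Y) (t : SubStoch X' Y') : SubStoch (X × X') (Y × Y') :=
  fun x => (s x.1).bind fun y => (t x.2).bind fun y' => SubDist.pure (y, y')

/-- The state of certain knowledge `[x]`. -/
def point (x : X) : SubStoch PUnit.{u + 1} X := det fun _ => x

/-- Marginalisation, which is also the tautological effect `⊤`. -/
def discard (X : Type u) : SubStoch X PUnit.{u + 1} := det fun _ => PUnit.unit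

/-- Broadcasting. -/
def copy (X : Type u) : SubStoch X (X × X) := det fun x => (x, x)

theorem det_comp_det (f : X → Y) (g : Y → Z) : (det f).comp (det g) = det fun x => g (f x) := by
  funext x; exact SubDist.pure_bind _ _

theorem det_tensor_det (f : X → Y) (g : X' → Y') :
    (det f).tensor (det g) = det fun x => (f x.1, g x.2) := by
  funext x; simp [tensor, det, SubDist.pure_bind]

theorem pentagon (X Y Z T : Type u) :
    ((det (Equiv.prodAssoc X Y Z)).tensor (id T)).comp
        ((det (Equiv.prodAssoc X (Y × Z) T)).comp ((id X).tensor (det (Equiv.prodAssoc Y Z T))))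
      = (det (Equiv.prodAssoc (X × Y) Z T)).comp (det (Equiv.prodAssoc X Y (Z × T))) := by
  simp only [id, det_tensor_det, det_comp_det]; rfl

theorem triangle (X Y : Type u) :
    (det (Equiv.prodAssoc X PUnit Y)).comp ((id X).tensor (det (Equiv.punitProd Y)))
      = (det (Equiv.prodPUnit X)).tensor (id Y) := by
  simp only [id, det_tensor_det, det_comp_det]; rfl

theorem hexagon (X Y Z : Type u) :
    (det (Equiv.prodAssoc X Y Z)).comp
        ((det (Equiv.prodComm X (Y × Z))).comp (det (Equiv.prodAssoc Y Z X)))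
      = ((det (Equiv.prodComm X Y)).tensor (id Z)).comp
        ((det (Equiv.prodAssoc Y X Z)).comp ((id Y).tensor (det (Equiv.prodComm X Z)))) := by
  simp only [id, det_tensor_det, det_comp_det]; rfl

theorem hexagonInv (X Y Z : Type u) :
    (det (Equiv.prodAssoc X Y Z).symm).comp
        ((det (Equiv.prodComm (X × Y) Z)).comp (det (Equiv.prodAssoc Z X Y).symm))
      = ((id X).tensor (det (Equiv.prodComm Y Z))).comp
        ((det (Equiv.prodAssoc X Z Y).symm).comp ((det (Equiv.prodComm X Z)).tensor (id Y))) := by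
  simp only [id, det_tensor_det, det_comp_det]; rfl

end SubStoch

/-! ## The free process theory of laboratory procedures

Process theories are symmetric monoidal categories. -/

/-- Systems generated by primitive general systems `G` and primitive classical systems `K`
under parallel composition. -/
inductive ProcSys (G K : Type u) : Type u
  | general (a : G) : ProcSys G K
  | classical (x : K) : ProcSys G K
  | unit : ProcSys G K
  | tensor (A B : ProcSys G K) : ProcSys G K

/-- The data that specify a theory of laboratory procedures: primitive nonclassical systems,
primitive classical systems with their sets of states, and primitive procedures with their
input and output systems. -/
structure ProcSignature where
  General : Type u
  Classical : Type u
  states : Classical → Type u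
  Procedure : Type u
  input : Procedure → ProcSys General Classical
  output : Procedure → ProcSys General Classical

/-- Diagrams of procedures, as formal composites. -/
inductive ProcTerm (S : ProcSignature.{u}) :
    ProcSys S.General S.Classical → ProcSys S.General S.Classical → Type u
  | box (b : S.Procedure) : ProcTerm S (S.input b) (S.output b)
  | id (A) : ProcTerm S A A
  | comp {A B C} (f : ProcTerm S A B) (g : ProcTerm S B C) : ProcTerm S A C
  | par {A B C D} (f : ProcTerm S A B) (g : ProcTerm S C D) : ProcTerm S (.tensor A C) (.tensor B D)
  | assoc (A B C) : ProcTerm S (.tensor (.tensor A B) C) (.tensor A (.tensor B C))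
  | assocInv (A B C) : ProcTerm S (.tensor A (.tensor B C)) (.tensor (.tensor A B) C)
  | left (A) : ProcTerm S (.tensor .unit A) A
  | leftInv (A) : ProcTerm S A (.tensor .unit A)
  | right (A) : ProcTerm S (.tensor A .unit) A
  | rightInv (A) : ProcTerm S A (.tensor A .unit)
  | swap (A B) : ProcTerm S (.tensor A B) (.tensor B A)

namespace ProcTerm

/-- The moves that identify formal composites with the same wiring: the symmetric monoidal
category laws, and nothing else. -/
inductive Rel (S : ProcSignature.{u}) : ∀ {A B}, ProcTerm S A B → ProcTerm S A B → Prop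
  | comp_left {A B C} {f f' : ProcTerm S A B} (g : ProcTerm S B C) :
      Rel S f f' → Rel S (f.comp g) (f'.comp g)
  | comp_right {A B C} (f : ProcTerm S A B) {g g' : ProcTerm S B C} :
      Rel S g g' → Rel S (f.comp g) (f.comp g')
  | par_left {A B C D} {f f' : ProcTerm S A B} (g : ProcTerm S C D) :
      Rel S f f' → Rel S (f.par g) (f'.par g)
  | par_right {A B C D} (f : ProcTerm S A B) {g g' : ProcTerm S C D} :
      Rel S g g' → Rel S (f.par g) (f.par g')
  | id_comp {A B} (f : ProcTerm S A B) : Rel S ((id A).comp f) f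
  | comp_id {A B} (f : ProcTerm S A B) : Rel S (f.comp (id B)) f
  | comp_assoc {A B C D} (f : ProcTerm S A B) (g : ProcTerm S B C) (h : ProcTerm S C D) :
      Rel S ((f.comp g).comp h) (f.comp (g.comp h))
  | par_id (A B) : Rel S ((id A).par (id B)) (id (.tensor A B))
  | par_comp {A B C A' B' C'} (f : ProcTerm S A B) (g : ProcTerm S B C)
      (f' : ProcTerm S A' B') (g' : ProcTerm S B' C') :
      Rel S ((f.par f').comp (g.par g')) ((f.comp g).par (f'.comp g'))
  | assoc_assocInv (A B C) : Rel S ((assoc A B C).comp (assocInv A B C)) (id _)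
  | assocInv_assoc (A B C) : Rel S ((assocInv A B C).comp (assoc A B C)) (id _)
  | left_leftInv (A) : Rel S ((left A).comp (leftInv A)) (id _)
  | leftInv_left (A) : Rel S ((leftInv A).comp (left A)) (id _)
  | right_rightInv (A) : Rel S ((right A).comp (rightInv A)) (id _)
  | rightInv_right (A) : Rel S ((rightInv A).comp (right A)) (id _)
  | swap_swap (A B) : Rel S ((swap A B).comp (swap B A)) (id _)
  | assoc_natural {A B C A' B' C'} (f : ProcTerm S A A') (g : ProcTerm S B B')
      (h : ProcTerm S C C') :
      Rel S (((f.par g).par h).comp (assoc A' B' C')) ((assoc A B C).comp (f.par (g.par h)))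
  | left_natural {A B} (f : ProcTerm S A B) :
      Rel S (((id .unit).par f).comp (left B)) ((left A).comp f)
  | right_natural {A B} (f : ProcTerm S A B) :
      Rel S ((f.par (id .unit)).comp (right B)) ((right A).comp f)
  | swap_natural {A B C D} (f : ProcTerm S A B) (g : ProcTerm S C D) :
      Rel S ((f.par g).comp (swap B D)) ((swap A C).comp (g.par f))
  | pentagon (A B C D) :
      Rel S (((assoc A B C).par (id D)).comp
          ((assoc A (.tensor B C) D).comp ((id A).par (assoc B C D))))
        ((assoc (.tensor A B) C D).comp (assoc A B (.tensor C D)))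
  | triangle (A B) :
      Rel S ((assoc A .unit B).comp ((id A).par (left B))) ((right A).par (id B))
  | hexagon (A B C) :
      Rel S ((assoc A B C).comp ((swap A (.tensor B C)).comp (assoc B C A)))
        (((swap A B).par (id C)).comp ((assoc B A C).comp ((id B).par (swap A C))))
  | hexagonInv (A B C) :
      Rel S ((assocInv A B C).comp ((swap (.tensor A B) C).comp (assocInv C A B)))
        (((id A).par (swap B C)).comp ((assocInv A C B).comp ((swap A C).par (id B))))

end ProcTerm

/-- The process theory of laboratory procedures freely generated by a signature. -/
def Proc (S : ProcSignature.{u}) : Type u := ProcSys S.General S.Classical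

namespace Proc

variable (S : ProcSignature.{u})

instance : Category.{u} (Proc S) where
  Hom A B := Quot (ProcTerm.Rel S (A := A) (B := B))
  id A := Quot.mk _ (ProcTerm.id A)
  comp := Quot.map₂ ProcTerm.comp (fun f _ _ h => .comp_right f h) (fun _ _ g h => .comp_left g h)
  id_comp := by rintro _ _ ⟨f⟩; exact Quot.sound (.id_comp f)
  comp_id := by rintro _ _ ⟨f⟩; exact Quot.sound (.comp_id f)
  assoc := by rintro _ _ _ _ ⟨f⟩ ⟨g⟩ ⟨h⟩; exact Quot.sound (.comp_assoc f g h)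

instance : MonoidalCategoryStruct (Proc S) where
  tensorObj A B := ProcSys.tensor A B
  tensorUnit := ProcSys.unit
  tensorHom := Quot.map₂ ProcTerm.par (fun f _ _ h => .par_right f h) (fun _ _ g h => .par_left g h)
  whiskerLeft A {_ _} f :=
    Quot.map (fun t => (ProcTerm.id A).par t) (fun _ _ h => .par_right _ h) f
  whiskerRight f B :=
    Quot.map (fun t => t.par (ProcTerm.id B)) (fun _ _ h => .par_left _ h) f
  associator A B C := ⟨Quot.mk _ (.assoc A B C), Quot.mk _ (.assocInv A B C),
    Quot.sound (.assoc_assocInv A B C), Quot.sound (.assocInv_assoc A B C)⟩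
  leftUnitor A := ⟨Quot.mk _ (.left A), Quot.mk _ (.leftInv A),
    Quot.sound (.left_leftInv A), Quot.sound (.leftInv_left A)⟩
  rightUnitor A := ⟨Quot.mk _ (.right A), Quot.mk _ (.rightInv A),
    Quot.sound (.right_rightInv A), Quot.sound (.rightInv_right A)⟩

instance : MonoidalCategory (Proc S) := MonoidalCategory.ofTensorHom
  (id_tensorHom_id := fun A B => Quot.sound (.par_id A B))
  (id_tensorHom := by rintro _ _ _ ⟨f⟩; rfl)
  (tensorHom_id := by rintro _ _ ⟨f⟩ _; rfl)
  (tensorHom_comp_tensorHom := by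
    rintro _ _ _ _ _ _ ⟨f⟩ ⟨f'⟩ ⟨g⟩ ⟨g'⟩; exact Quot.sound (.par_comp f g f' g'))
  (associator_naturality := by
    rintro _ _ _ _ _ _ ⟨f⟩ ⟨g⟩ ⟨h⟩; exact Quot.sound (.assoc_natural f g h))
  (leftUnitor_naturality := by rintro _ _ ⟨f⟩; exact Quot.sound (.left_natural f))
  (rightUnitor_naturality := by rintro _ _ ⟨f⟩; exact Quot.sound (.right_natural f))
  (pentagon := fun A B C D => Quot.sound (.pentagon A B C D))
  (triangle := fun A B => Quot.sound (.triangle A B))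

instance : SymmetricCategory (Proc S) where
  braiding A B := ⟨Quot.mk _ (.swap A B), Quot.mk _ (.swap B A),
    Quot.sound (.swap_swap A B), Quot.sound (.swap_swap B A)⟩
  braiding_naturality_right := by
    rintro A _ _ ⟨f⟩; exact Quot.sound (.swap_natural (.id A) f)
  braiding_naturality_left := by
    rintro _ _ ⟨f⟩ A; exact Quot.sound (.swap_natural f (.id A))
  hexagon_forward A B C := Quot.sound (.hexagon A B C)
  hexagon_reverse A B C := Quot.sound (.hexagonInv A B C)
  symmetry A B := Quot.sound (.swap_swap A B)

/-- The classical systems: the composites of primitive classical systems. -/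
def IsClassical : ProcSys S.General S.Classical → Prop
  | .general _ => False
  | .classical _ => True
  | .unit => True
  | .tensor A B => IsClassical A ∧ IsClassical B

/-- The set of states of a classical system. -/
def states : ∀ A : ProcSys S.General S.Classical, IsClassical S A → Type u
  | .general _, h => h.elim
  | .classical x, _ => S.states x
  | .unit, _ => PUnit
  | .tensor A B, h => states A h.1 × states B h.2

end Proc

/-! ## The process theory of functional dynamics -/

/-- A finite set of ontic states. -/
structure Func where
  carrier : Type u
  [finite : Finite carrier]

namespace Func

instance : Category.{u} Func.{u} where
  Hom A B := A.carrier → B.carrier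
  id _ := fun x => x
  comp f g := fun x => g (f x)

/-- The function underlying a process of functional dynamics. -/
def Hom.toFun {A B : Func.{u}} (f : A ⟶ B) : A.carrier → B.carrier := f

/-- A function between sets of ontic states, as a process of functional dynamics. -/
def ofFun {A B : Func.{u}} (f : A.carrier → B.carrier) : A ⟶ B := f

/-- The singleton set. -/
def star : Func.{u} := ⟨PUnit⟩

/-- The Cartesian product. -/
def prod (A B : Func.{u}) : Func.{u} :=
  haveI := A.finite
  haveI := B.finite
  ⟨A.carrier × B.carrier⟩

instance : MonoidalCategoryStruct Func.{u} where
  tensorObj := prod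
  tensorUnit := star
  tensorHom f g := fun x => (f x.1, g x.2)
  whiskerLeft _ _ _ f := fun x => (x.1, f x.2)
  whiskerRight f _ := fun x => (f x.1, x.2)
  associator _ _ _ := ⟨fun x => (x.1.1, x.1.2, x.2), fun x => ((x.1, x.2.1), x.2.2), rfl, rfl⟩
  leftUnitor _ := ⟨fun x => x.2, fun x => (PUnit.unit, x), rfl, rfl⟩
  rightUnitor _ := ⟨fun x => x.1, fun x => (x, PUnit.unit), rfl, rfl⟩

instance : MonoidalCategory Func.{u} := MonoidalCategory.ofTensorHom
  (id_tensorHom_id := fun _ _ => rfl)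
  (id_tensorHom := fun _ _ _ _ => rfl)
  (tensorHom_id := fun _ _ => rfl)
  (tensorHom_comp_tensorHom := fun _ _ _ _ => rfl)
  (associator_naturality := fun _ _ _ => rfl)
  (leftUnitor_naturality := fun _ => rfl)
  (rightUnitor_naturality := fun _ => rfl)
  (pentagon := fun _ _ _ _ => rfl)
  (triangle := fun _ _ => rfl)

instance : SymmetricCategory Func.{u} where
  braiding _ _ := ⟨fun x => (x.2, x.1), fun x => (x.2, x.1), rfl, rfl⟩
  braiding_naturality_right _ _ _ _ := rfl
  braiding_naturality_left _ _ := rfl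
  hexagon_forward _ _ _ := rfl
  hexagon_reverse _ _ _ := rfl
  symmetry _ _ := rfl

end Func

/-! ## Causal-inferential theories over a causal theory -/

/-- Which causal systems one can directly gain knowledge about, with their sets of states. The
composite of two such systems has the Cartesian product as its set of states. -/
structure Readout (C : Type w) [Category.{u} C] [MonoidalCategory C] where
  IsClassical : C → Prop
  states : ∀ A, IsClassical A → Type u
  tensor : ∀ {A B}, IsClassical A → IsClassical B → IsClassical (A ⊗ B)
  split : ∀ {A B} (hA : IsClassical A) (hB : IsClassical B),
    states (A ⊗ B) (tensor hA hB) ≃ states A hA × states B hB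

/-- A system of a causal-inferential theory: a causal system and an inferential system. -/
structure CISys (C : Type w) where
  caus : C
  inf : Type u

/-- Parallel composition of systems. -/
@[reducible]
def CISys.tensor {C : Type w} [Category.{u} C] [MonoidalCategory C] (P Q : CISys.{u} C) :
    CISys.{u} C :=
  ⟨P.caus ⊗ Q.caus, P.inf × Q.inf⟩

section Diagrams

variable {C : Type w} [Category.{u} C] [MonoidalCategory.{u} C] [SymmetricCategory.{u} C]

/-- Formal causal-inferential diagrams. `embed t s` is the causal process `t`, embedded as a
process about which one has certain knowledge, next to the inferential process `s`; in particular
it provides all the bits of wiring. The three generators are `know` (feeding knowledge of the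
causal process into the causal process), `learn` (gaining knowledge about a classical causal
system) and `ignore`. -/
inductive Diag (K : Readout.{u} C) : CISys.{u} C → CISys.{u} C → Type max w (u + 1)
  | id (P) : Diag K P P
  | comp {P Q R} (D : Diag K P Q) (E : Diag K Q R) : Diag K P R
  | par {P Q P' Q'} (D : Diag K P Q) (E : Diag K P' Q') : Diag K (P.tensor P') (Q.tensor Q')
  | embed {A B : C} {X Y : Type u} (t : A ⟶ B) (s : SubStoch X Y) : Diag K ⟨A, X⟩ ⟨B, Y⟩
  | know (A B : C) : Diag K ⟨A, A ⟶ B⟩ ⟨B, PUnit⟩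
  | learn (A : C) (h : K.IsClassical A) : Diag K ⟨A, PUnit⟩ ⟨A, K.states A h⟩
  | ignore (A : C) : Diag K ⟨A, PUnit⟩ ⟨𝟙_ C, PUnit⟩

namespace Diag

variable {K : Readout.{u} C}

/-- An inferential process, while the causal system `A` passes by. -/
@[reducible]
def infer (A : C) {X Y : Type u} (s : SubStoch X Y) : Diag K ⟨A, X⟩ ⟨A, Y⟩ := embed (𝟙 A) s

/-- A diagram next to a spectator inferential system `Z`. -/
def beside {A B : C} {X Y : Type u} (D : Diag K ⟨A, X⟩ ⟨B, Y⟩) (Z : Type u) :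
    Diag K ⟨A, X × Z⟩ ⟨B, Y × Z⟩ :=
  (embed (ρ_ A).inv (SubStoch.id (X × Z))).comp
    ((par D (id ⟨𝟙_ C, Z⟩)).comp (embed (ρ_ B).hom (SubStoch.id (Y × Z))))

/-- Updating knowledge of two processes to knowledge of their sequential composite. -/
def seqComp (A B B' : C) : SubStoch ((A ⟶ B) × (B ⟶ B')) (A ⟶ B') :=
  SubStoch.det fun f => f.1 ≫ f.2

/-- Updating knowledge of two processes to knowledge of their parallel composite. -/
def parComp (A B A' B' : C) : SubStoch ((A ⟶ B) × (A' ⟶ B')) (A ⊗ A' ⟶ B ⊗ B') :=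
  SubStoch.det fun f => f.1 ⊗ₘ f.2

/-- The rewrite rules common to all causal-inferential theories, together with the additional
rules `R`. -/
inductive Rel (R : ∀ P Q : CISys.{u} C, Diag K P Q → Diag K P Q → Prop) :
    ∀ {P Q : CISys.{u} C}, Diag K P Q → Diag K P Q → Prop
  | extra {P Q : CISys.{u} C} {D E : Diag K P Q} : R P Q D E → Rel R D E
  -- rewriting inside a diagram
  | comp_left {P Q T : CISys.{u} C} {D D' : Diag K P Q} (E : Diag K Q T) :
      Rel R D D' → Rel R (D.comp E) (D'.comp E)
  | comp_right {P Q T : CISys.{u} C} (D : Diag K P Q) {E E' : Diag K Q T} :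
      Rel R E E' → Rel R (D.comp E) (D.comp E')
  | par_left {P Q P' Q' : CISys.{u} C} {D D' : Diag K P Q} (E : Diag K P' Q') :
      Rel R D D' → Rel R (D.par E) (D'.par E)
  | par_right {P Q P' Q' : CISys.{u} C} (D : Diag K P Q) {E E' : Diag K P' Q'} :
      Rel R E E' → Rel R (D.par E) (D.par E')
  -- only the connectivity of a diagram matters
  | id_comp {P Q : CISys.{u} C} (D : Diag K P Q) : Rel R ((id P).comp D) D
  | comp_id {P Q : CISys.{u} C} (D : Diag K P Q) : Rel R (D.comp (id Q)) D
  | comp_assoc {P Q T U : CISys.{u} C} (D : Diag K P Q) (E : Diag K Q T) (F : Diag K T U) :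
      Rel R ((D.comp E).comp F) (D.comp (E.comp F))
  | par_id (P Q : CISys.{u} C) : Rel R ((id P).par (id Q)) (id (P.tensor Q))
  | par_comp {P Q T P' Q' T' : CISys.{u} C} (D : Diag K P Q) (E : Diag K Q T) (D' : Diag K P' Q')
      (E' : Diag K Q' T') :
      Rel R ((D.par D').comp (E.par E')) ((D.comp E).par (D'.comp E'))
  | assoc_natural {A A' B B' F F' : C} {X X' Y Y' Z Z' : Type u} (D : Diag K ⟨A, X⟩ ⟨A', X'⟩)
      (E : Diag K ⟨B, Y⟩ ⟨B', Y'⟩) (G : Diag K ⟨F, Z⟩ ⟨F', Z'⟩) :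
      Rel R (((D.par E).par G).comp
          (embed (α_ A' B' F').hom (SubStoch.det (Equiv.prodAssoc X' Y' Z'))))
        ((embed (α_ A B F).hom (SubStoch.det (Equiv.prodAssoc X Y Z))).comp (D.par (E.par G)))
  | left_natural {A B : C} {X Y : Type u} (D : Diag K ⟨A, X⟩ ⟨B, Y⟩) :
      Rel R (((id ⟨𝟙_ C, PUnit.{u + 1}⟩).par D).comp (embed (λ_ B).hom (SubStoch.det Prod.snd)))
        ((embed (λ_ A).hom (SubStoch.det Prod.snd)).comp D)
  | right_natural {A B : C} {X Y : Type u} (D : Diag K ⟨A, X⟩ ⟨B, Y⟩) :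
      Rel R ((D.par (id ⟨𝟙_ C, PUnit.{u + 1}⟩)).comp (embed (ρ_ B).hom (SubStoch.det Prod.fst)))
        ((embed (ρ_ A).hom (SubStoch.det Prod.fst)).comp D)
  | swap_natural {A A' B B' : C} {X X' Y Y' : Type u} (D : Diag K ⟨A, X⟩ ⟨A', X'⟩)
      (E : Diag K ⟨B, Y⟩ ⟨B', Y'⟩) :
      Rel R ((D.par E).comp (embed (β_ A' B').hom (SubStoch.det Prod.swap)))
        ((embed (β_ A B).hom (SubStoch.det Prod.swap)).comp (E.par D))
  -- causal and inferential processes compose as in the causal and inferential theories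
  | embed_id (A : C) (X : Type u) : Rel R (embed (𝟙 A) (SubStoch.id X)) (id ⟨A, X⟩)
  | embed_comp {A B F : C} {X Y Z : Type u} (t : A ⟶ B) (t' : B ⟶ F) (s : SubStoch X Y)
      (s' : SubStoch Y Z) :
      Rel R ((embed t s).comp (embed t' s')) (embed (t ≫ t') (s.comp s'))
  | embed_par {A B A' B' : C} {X Y X' Y' : Type u} (t : A ⟶ B) (s : SubStoch X Y)
      (t' : A' ⟶ B') (s' : SubStoch X' Y') :
      Rel R ((embed t s).par (embed t' s')) (embed (t ⊗ₘ t') (s.tensor s'))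
  -- an embedded causal process is one about which one has certain knowledge
  | embed_know {A B : C} (t : A ⟶ B) :
      Rel R (embed t (SubStoch.id PUnit.{u + 1})) ((infer A (SubStoch.point t)).comp (know A B))
  -- knowledge of composite processes
  | know_seq (A B F : C) :
      Rel R (((know A B).beside (B ⟶ F)).comp
          ((infer B (SubStoch.det Prod.snd)).comp (know B F)))
        ((infer A (seqComp A B F)).comp (know A F))
  | know_par (A B A' B' : C) :
      Rel R (((know A B).par (know A' B')).comp (infer (B ⊗ B') (SubStoch.discard _)))
        ((infer (A ⊗ A') (parComp A B A' B')).comp (know (A ⊗ A') (B ⊗ B')))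
  -- asking the tautological question is asking nothing
  | learn_discard (A : C) (h : K.IsClassical A) :
      Rel R ((learn A h).comp (infer A (SubStoch.discard _))) (id ⟨A, PUnit.{u + 1}⟩)
  -- learning twice is copying what was learned
  | learn_learn (A : C) (h : K.IsClassical A) :
      Rel R ((learn A h).comp ((infer A (SubStoch.det fun x => (PUnit.unit, x))).comp
          ((learn A h).beside (K.states A h))))
        ((learn A h).comp (infer A (SubStoch.copy (K.states A h))))
  -- learning about a composite system
  | learn_par {A B : C} (hA : K.IsClassical A) (hB : K.IsClassical B) :
      Rel R ((learn (A ⊗ B) (K.tensor hA hB)).comp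
          (infer (A ⊗ B) (SubStoch.det (K.split hA hB))))
        ((infer (A ⊗ B) (SubStoch.copy PUnit.{u + 1})).comp ((learn A hA).par (learn B hB)))
  -- ignoring composite systems, and the trivial system
  | ignore_par (A B : C) :
      Rel R (ignore (A ⊗ B))
        ((infer (A ⊗ B) (SubStoch.copy PUnit.{u + 1})).comp
          (((ignore A).par (ignore B)).comp
            (embed (λ_ (𝟙_ C)).hom (SubStoch.discard _))))
  | ignore_unit : Rel R (ignore (𝟙_ C)) (id ⟨𝟙_ C, PUnit.{u + 1}⟩)
  -- ignorability
  | know_ignore (A B : C) :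
      Rel R ((know A B).comp (ignore B)) ((infer A (SubStoch.discard _)).comp (ignore A))

end Diag

/-- The causal-inferential theory with readout `K` and additional rewrite rules `R`: its systems
are pairs of a causal and an inferential system, its processes are diagrams modulo rewriting. -/
def CI (K : Readout.{u} C) (_R : ∀ P Q : CISys.{u} C, Diag K P Q → Diag K P Q → Prop) :
    Type max w (u + 1) :=
  CISys.{u} C

namespace CI

variable (K : Readout.{u} C) (R : ∀ P Q : CISys.{u} C, Diag K P Q → Diag K P Q → Prop)

instance : Category.{max w (u + 1)} (CI K R) where
  Hom P Q := Quot (Diag.Rel R (P := P) (Q := Q))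
  id P := Quot.mk _ (Diag.id P)
  comp := Quot.map₂ Diag.comp (fun D _ _ h => .comp_right D h) (fun _ _ E h => .comp_left E h)
  id_comp := by rintro _ _ ⟨D⟩; exact Quot.sound (.id_comp D)
  comp_id := by rintro _ _ ⟨D⟩; exact Quot.sound (.comp_id D)
  assoc := by rintro _ _ _ _ ⟨D⟩ ⟨E⟩ ⟨F⟩; exact Quot.sound (.comp_assoc D E F)

variable {K} in
/-- The system with causal part `A` and inferential part `X`. -/
def sys (A : C) (X : Type u) : CI K R := CISys.mk A X

variable {K} in
/-- A causal and an inferential process side by side. -/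
def embed {A B : C} {X Y : Type u} (t : A ⟶ B) (s : SubStoch X Y) : sys R A X ⟶ sys R B Y :=
  Quot.mk _ (Diag.embed t s)

/-- The generator that feeds knowledge of a causal process into the causal process. -/
def know (A B : C) : sys R A (A ⟶ B) ⟶ sys R B PUnit := Quot.mk _ (Diag.know A B)

/-- The generator that learns about a classical causal system. -/
def learn (A : C) (h : K.IsClassical A) : sys R A PUnit ⟶ sys R A (K.states A h) :=
  Quot.mk _ (Diag.learn A h)

/-- The generator that ignores a causal system. -/
def ignore (A : C) : sys R A PUnit ⟶ sys R (𝟙_ C) PUnit := Quot.mk _ (Diag.ignore A)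

variable {K R}

theorem embed_comp {A B F : C} {X Y Z : Type u} (t : A ⟶ B) (t' : B ⟶ F) (s : SubStoch X Y)
    (s' : SubStoch Y Z) : embed R t s ≫ embed R t' s' = embed R (t ≫ t') (s.comp s') :=
  Quot.sound (.embed_comp t t' s s')

theorem embed_id (A : C) (X : Type u) : embed R (𝟙 A) (SubStoch.id X) = 𝟙 (sys R A X) :=
  Quot.sound (.embed_id A X)

variable (R) in
/-- The bits of wiring of a causal-inferential theory. -/
def wiring {A B : C} {X Y : Type u} (t : A ≅ B) (s : X ≃ Y) : sys R A X ≅ sys R B Y where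
  hom := embed R t.hom (SubStoch.det s)
  inv := embed R t.inv (SubStoch.det s.symm)
  hom_inv_id := by simp [embed_comp, SubStoch.det_comp_det, ← embed_id, SubStoch.id]
  inv_hom_id := by simp [embed_comp, SubStoch.det_comp_det, ← embed_id, SubStoch.id]

instance : MonoidalCategoryStruct (CI K R) where
  tensorObj P Q := CISys.tensor (C := C) P Q
  tensorUnit := sys R (𝟙_ C) PUnit
  tensorHom := Quot.map₂ Diag.par (fun D _ _ h => .par_right D h) (fun _ _ E h => .par_left E h)
  whiskerLeft P {_ _} D :=
    Quot.map (fun t => (Diag.id P).par t) (fun _ _ h => .par_right _ h) D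
  whiskerRight D Q :=
    Quot.map (fun t => t.par (Diag.id Q)) (fun _ _ h => .par_left _ h) D
  associator P Q T := wiring R (α_ P.caus Q.caus T.caus) (Equiv.prodAssoc P.inf Q.inf T.inf)
  leftUnitor P := wiring R (λ_ P.caus) (Equiv.punitProd P.inf)
  rightUnitor P := wiring R (ρ_ P.caus) (Equiv.prodPUnit P.inf)

theorem embed_tensor {A B A' B' : C} {X Y X' Y' : Type u} (t : A ⟶ B) (s : SubStoch X Y)
    (t' : A' ⟶ B') (s' : SubStoch X' Y') :
    (embed R t s ⊗ₘ embed R t' s') = embed R (t ⊗ₘ t') (s.tensor s') :=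
  Quot.sound (.embed_par t s t' s')

set_option linter.unusedSectionVars false in
theorem pentagon_tensorHom (A B F G : C) :
    ((α_ A B F).hom ⊗ₘ 𝟙 G) ≫ (α_ A (B ⊗ F) G).hom ≫ (𝟙 A ⊗ₘ (α_ B F G).hom) =
      (α_ (A ⊗ B) F G).hom ≫ (α_ A B (F ⊗ G)).hom := by
  simp

theorem hexagon_tensorHom (A B F : C) :
    (α_ A B F).hom ≫ (β_ A (B ⊗ F)).hom ≫ (α_ B F A).hom =
      ((β_ A B).hom ⊗ₘ 𝟙 F) ≫ (α_ B A F).hom ≫ (𝟙 B ⊗ₘ (β_ A F).hom) := by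
  simp

theorem hexagonInv_tensorHom (A B F : C) :
    (α_ A B F).inv ≫ (β_ (A ⊗ B) F).hom ≫ (α_ F A B).inv =
      (𝟙 A ⊗ₘ (β_ B F).hom) ≫ (α_ A F B).inv ≫ ((β_ A F).hom ⊗ₘ 𝟙 B) := by
  simp

instance : MonoidalCategory (CI K R) := MonoidalCategory.ofTensorHom
  (id_tensorHom_id := fun P Q => Quot.sound (.par_id P Q))
  (id_tensorHom := by rintro _ _ _ ⟨D⟩; rfl)
  (tensorHom_id := by rintro _ _ ⟨D⟩ _; rfl)
  (tensorHom_comp_tensorHom := by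
    rintro _ _ _ _ _ _ ⟨D⟩ ⟨D'⟩ ⟨E⟩ ⟨E'⟩; exact Quot.sound (.par_comp D E D' E'))
  (associator_naturality := by
    rintro ⟨⟩ ⟨⟩ ⟨⟩ ⟨⟩ ⟨⟩ ⟨⟩ ⟨D⟩ ⟨E⟩ ⟨G⟩; exact Quot.sound (.assoc_natural D E G))
  (leftUnitor_naturality := by rintro ⟨⟩ ⟨⟩ ⟨D⟩; exact Quot.sound (.left_natural D))
  (rightUnitor_naturality := by rintro ⟨⟩ ⟨⟩ ⟨D⟩; exact Quot.sound (.right_natural D))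
  (pentagon := fun P Q T U => by
    change (embed R (α_ P.caus Q.caus T.caus).hom _ ⊗ₘ 𝟙 (sys R U.caus U.inf)) ≫
      embed R (α_ P.caus (Q.caus ⊗ T.caus) U.caus).hom _ ≫
        (𝟙 (sys R P.caus P.inf) ⊗ₘ embed R (α_ Q.caus T.caus U.caus).hom _) =
      embed R (α_ (P.caus ⊗ Q.caus) T.caus U.caus).hom _ ≫
        embed R (α_ P.caus Q.caus (T.caus ⊗ U.caus)).hom _
    rw [← embed_id, ← embed_id, embed_tensor, embed_tensor]
    refine (congrArg₂ _ rfl (embed_comp _ _ _ _)).trans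
      ((embed_comp _ _ _ _).trans (Eq.trans ?_ (embed_comp _ _ _ _).symm))
    exact congrArg₂ (embed R) (pentagon_tensorHom P.caus Q.caus T.caus U.caus)
      (SubStoch.pentagon P.inf Q.inf T.inf U.inf))
  (triangle := fun P Q => by
    change embed R (α_ P.caus (𝟙_ C) Q.caus).hom _ ≫
        (𝟙 (sys R P.caus P.inf) ⊗ₘ embed R (λ_ Q.caus).hom _) =
      embed R (ρ_ P.caus).hom _ ⊗ₘ 𝟙 (sys R Q.caus Q.inf)
    rw [← embed_id, ← embed_id, embed_tensor, embed_tensor]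
    refine (embed_comp _ _ _ _).trans ?_
    exact congrArg₂ (embed R) (by simp) (SubStoch.triangle P.inf Q.inf))

instance : SymmetricCategory (CI K R) where
  braiding P Q := wiring R (β_ P.caus Q.caus) (Equiv.prodComm P.inf Q.inf)
  braiding_naturality_right := by
    rintro ⟨A, X⟩ ⟨⟩ ⟨⟩ ⟨D⟩; exact Quot.sound (.swap_natural (.id ⟨A, X⟩) D)
  braiding_naturality_left := by
    rintro ⟨⟩ ⟨⟩ ⟨D⟩ ⟨A, X⟩; exact Quot.sound (.swap_natural D (.id ⟨A, X⟩))
  hexagon_forward P Q T := by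
    rw [← MonoidalCategory.tensorHom_id, ← MonoidalCategory.id_tensorHom]
    change embed R (α_ P.caus Q.caus T.caus).hom _ ≫ embed R (β_ P.caus (Q.caus ⊗ T.caus)).hom _ ≫
        embed R (α_ Q.caus T.caus P.caus).hom _ =
      (embed R (β_ P.caus Q.caus).hom _ ⊗ₘ 𝟙 (sys R T.caus T.inf)) ≫
        embed R (α_ Q.caus P.caus T.caus).hom _ ≫
          (𝟙 (sys R Q.caus Q.inf) ⊗ₘ embed R (β_ P.caus T.caus).hom _)
    rw [← embed_id, ← embed_id, embed_tensor, embed_tensor]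
    refine (congrArg₂ _ rfl (embed_comp _ _ _ _)).trans ((embed_comp _ _ _ _).trans
      (Eq.trans ?_ ((congrArg₂ _ rfl (embed_comp _ _ _ _)).trans (embed_comp _ _ _ _)).symm))
    exact congrArg₂ (embed R) (hexagon_tensorHom P.caus Q.caus T.caus)
      (SubStoch.hexagon P.inf Q.inf T.inf)
  hexagon_reverse P Q T := by
    rw [← MonoidalCategory.tensorHom_id, ← MonoidalCategory.id_tensorHom]
    change embed R (α_ P.caus Q.caus T.caus).inv _ ≫ embed R (β_ (P.caus ⊗ Q.caus) T.caus).hom _ ≫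
        embed R (α_ T.caus P.caus Q.caus).inv _ =
      (𝟙 (sys R P.caus P.inf) ⊗ₘ embed R (β_ Q.caus T.caus).hom _) ≫
        embed R (α_ P.caus T.caus Q.caus).inv _ ≫
          (embed R (β_ P.caus T.caus).hom _ ⊗ₘ 𝟙 (sys R Q.caus Q.inf))
    rw [← embed_id, ← embed_id]
    refine (congrArg₂ _ rfl (embed_comp _ _ _ _)).trans ((embed_comp _ _ _ _).trans
      (Eq.trans ?_ ((congrArg₂ _ (embed_tensor _ _ _ _) ((congrArg₂ _ rfl
        (embed_tensor _ _ _ _)).trans (embed_comp _ _ _ _))).trans (embed_comp _ _ _ _)).symm))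
    exact congrArg₂ (embed R) (hexagonInv_tensorHom P.caus Q.caus T.caus)
      (SubStoch.hexagonInv P.inf Q.inf T.inf)
  symmetry P Q := by
    refine (embed_comp _ _ _ _).trans (Eq.trans ?_ (embed_id _ _))
    exact congrArg₂ (embed R) (SymmetricCategory.symmetry _ _) (SubStoch.det_comp_det _ _)

/-- An inferential process, as a process without causal inputs or outputs. -/
def infer {X Y : Type u} (s : SubStoch X Y) : sys R (𝟙_ C) X ⟶ sys R (𝟙_ C) Y :=
  embed R (𝟙 (𝟙_ C)) s

variable (R) in
/-- The system with causal part `A` and inferential part `X` is the composite of the causal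
system `A` and the inferential system `X`. -/
def split (A : C) (X : Type u) : sys R A X ≅ sys R A PUnit ⊗ sys R (𝟙_ C) X :=
  wiring R (ρ_ A).symm (Equiv.punitProd X).symm

/-- Parallel composition of processes without causal inputs or outputs. -/
def inferTensor {X Y X' Y' : Type u} (D : sys R (𝟙_ C) X ⟶ sys R (𝟙_ C) Y)
    (E : sys R (𝟙_ C) X' ⟶ sys R (𝟙_ C) Y') :
    sys R (𝟙_ C) (X × X') ⟶ sys R (𝟙_ C) (Y × Y') :=
  (wiring R (λ_ (𝟙_ C)) (Equiv.refl (X × X'))).inv ≫ (D ⊗ₘ E) ≫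
    (wiring R (λ_ (𝟙_ C)) (Equiv.refl (Y × Y'))).hom

end CI

/-- A prediction map: a diagram-preserving map to substochastic maps, defined on the causally
closed processes (those without causal inputs or outputs), which is a left inverse of the
inclusion of the inferential theory. (Preservation of identities and of wiring is contained in
`map_infer`.) -/
structure PredictionMap (K : Readout.{u} C)
    (R : ∀ P Q : CISys.{u} C, Diag K P Q → Diag K P Q → Prop) where
  map : ∀ {X Y : Type u}, (CI.sys R (𝟙_ C) X ⟶ CI.sys R (𝟙_ C) Y) → SubStoch X Y
  map_comp : ∀ {X Y Z : Type u} (D : CI.sys R (𝟙_ C) X ⟶ CI.sys R (𝟙_ C) Y)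
    (E : CI.sys R (𝟙_ C) Y ⟶ CI.sys R (𝟙_ C) Z), map (D ≫ E) = (map D).comp (map E)
  map_tensor : ∀ {X Y X' Y' : Type u} (D : CI.sys R (𝟙_ C) X ⟶ CI.sys R (𝟙_ C) Y)
    (E : CI.sys R (𝟙_ C) X' ⟶ CI.sys R (𝟙_ C) Y'),
    map (CI.inferTensor D E) = (map D).tensor (map E)
  map_infer : ∀ {X Y : Type u} (s : SubStoch X Y), map (CI.infer s) = s

/-- Inferential equivalence with respect to a prediction map: equal predictions in every tester.
A tester consists of two processes connected by an auxiliary system `W`. -/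
def InferentiallyEquivalent {K : Readout.{u} C}
    {R : ∀ P Q : CISys.{u} C, Diag K P Q → Diag K P Q → Prop} (p : PredictionMap K R)
    {P Q : CI K R} (D E : P ⟶ Q) : Prop :=
  ∀ (W : CI K R) (X Y : Type u) (x : CI.sys R (𝟙_ C) X ⟶ P ⊗ W) (y : Q ⊗ W ⟶ CI.sys R (𝟙_ C) Y),
    p.map (x ≫ (D ⊗ₘ 𝟙 W) ≫ y) = p.map (x ≫ (E ⊗ₘ 𝟙 W) ≫ y)

end Diagrams

/-! ## Operational causal-inferential theories -/

/-- In a theory of procedures, one can directly learn about the classical systems. -/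
def Proc.readout (S : ProcSignature.{u}) : Readout.{u} (Proc S) where
  IsClassical := Proc.IsClassical S
  states := Proc.states S
  tensor hA hB := ⟨hA, hB⟩
  split _ _ := Equiv.refl _

/-- Operational theories have no rewrite rules beyond the common ones. -/
def Proc.rules (S : ProcSignature.{u}) (P Q : CISys.{u} (Proc S))
    (_ _ : Diag (Proc.readout S) P Q) : Prop := False

/-- The operational causal-inferential theory of the procedures generated by `S`. -/
abbrev PS (S : ProcSignature.{u}) : Type (u + 1) := CI (Proc.readout S) (Proc.rules S)

/-- Prediction maps of the operational theory. The choice of such a map completes the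
specification of an operational causal-inferential theory. -/
abbrev OperationalPredictions (S : ProcSignature.{u}) : Type (u + 1) :=
  PredictionMap (Proc.readout S) (Proc.rules S)

/-! ## The classical realist causal-inferential theory -/

namespace Func

/-- In functional dynamics, one can directly learn about every system. -/
def readout : Readout.{u} Func.{u} where
  IsClassical _ := True
  states A _ := A.carrier
  tensor _ _ := trivial
  split _ _ := Equiv.refl _

/-- Updating knowledge of a function and of its argument to knowledge of its value. -/
def apply (A B : Func.{u}) : SubStoch ((A ⟶ B) × A.carrier) B.carrier :=
  SubStoch.det fun x => Hom.toFun x.1 x.2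

/-- The additional rewrite rule of functional dynamics: learning about the output of a function is
the same as learning about its input and propagating this together with (a copy of) what is known
about the function. -/
inductive Rules : ∀ P Q : CISys.{u} Func.{u}, Diag readout P Q → Diag readout P Q → Prop
  | know_learn (A B : Func.{u}) :
      Rules ⟨A, A ⟶ B⟩ ⟨B, B.carrier⟩
        ((Diag.know A B).comp (Diag.learn (K := readout) B trivial))
        ((Diag.infer A (SubStoch.det fun f : A ⟶ B => (PUnit.unit, (f, f)))).comp
          (((Diag.learn (K := readout) A trivial).beside ((A ⟶ B) × (A ⟶ B))).comp
            ((Diag.infer A (SubStoch.det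
                fun x : A.carrier × (A ⟶ B) × (A ⟶ B) => (x.2.1, (x.2.2, x.1)))).comp
              (((Diag.know A B).beside ((A ⟶ B) × A.carrier)).comp
                ((Diag.infer B (SubStoch.det Prod.snd)).comp (Diag.infer B (apply A B)))))))

end Func

/-- The classical realist causal-inferential theory. -/
abbrev FS : Type (u + 1) := CI Func.readout.{u} Func.Rules.{u}

/-- Prediction maps of the classical realist theory. -/
abbrev RealistPredictions : Type (u + 1) := PredictionMap Func.readout.{u} Func.Rules.{u}

/-! ## Classical realist representations -/

/-- A choice of a set of ontic states for every primitive system. -/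
structure OnticStates (S : ProcSignature.{u}) where
  general : S.General → Func.{u}
  classical : S.Classical → Func.{u}

/-- The set `Λ_A` of ontic states of a system `A`. -/
def OnticStates.ont {S : ProcSignature.{u}} (L : OnticStates S) :
    ProcSys S.General S.Classical → Func.{u}
  | .general a => L.general a
  | .classical x => L.classical x
  | .unit => Func.star
  | .tensor A B => Func.prod (L.ont A) (L.ont B)

/-- The system of the realist theory that represents a system of the operational theory: causal
systems are represented by their ontic states, inferential systems by themselves. -/
def OnticStates.obj {S : ProcSignature.{u}} (L : OnticStates S) (P : PS S) : FS.{u} :=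
  CI.sys Func.Rules (L.ont P.caus) P.inf

/-- A diagram-preserving map from the operational to the classical realist theory, with ontic
states `L`. -/
structure DiagramPreservingMap {S : ProcSignature.{u}} (L : OnticStates S) where
  map : ∀ {P Q : PS S}, (P ⟶ Q) → (L.obj P ⟶ L.obj Q)
  map_id : ∀ P : PS S, map (𝟙 P) = 𝟙 (L.obj P)
  map_comp : ∀ {P Q T : PS S} (D : P ⟶ Q) (E : Q ⟶ T), map (D ≫ E) = map D ≫ map E
  map_tensor : ∀ {P Q P' Q' : PS S} (D : P ⟶ Q) (E : P' ⟶ Q'), map (D ⊗ₘ E) = map D ⊗ₘ map E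
  map_associator : ∀ P Q T : PS S, map (α_ P Q T).hom = (α_ (L.obj P) (L.obj Q) (L.obj T)).hom
  map_leftUnitor : ∀ P : PS S, map (λ_ P).hom = (λ_ (L.obj P)).hom
  map_rightUnitor : ∀ P : PS S, map (ρ_ P).hom = (ρ_ (L.obj P)).hom
  map_braiding : ∀ P Q : PS S, map (β_ P Q).hom = (β_ (L.obj P) (L.obj Q)).hom
  map_split : ∀ (A : Proc S) (X : Type u),
    map (CI.split (Proc.rules S) A X).hom = (CI.split Func.Rules (L.ont A) X).hom

/-- A classical realist representation with ontic states `L`: a diagram-preserving map that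
preserves predictions and ignorability. -/
structure ClassicalRealistRepresentation {S : ProcSignature.{u}} (p : OperationalPredictions S)
    (q : RealistPredictions.{u}) (L : OnticStates S) extends DiagramPreservingMap L where
  map_predictions : ∀ {X Y : Type u}
    (D : CI.sys (Proc.rules S) (𝟙_ (Proc S)) X ⟶ CI.sys (Proc.rules S) (𝟙_ (Proc S)) Y),
    q.map (map D) = p.map D
  map_ignore : ∀ A : Proc S,
    map (CI.ignore (Proc.readout S) (Proc.rules S) A) =
      CI.ignore Func.readout Func.Rules (L.ont A)

/-- The generator that feeds knowledge of a procedure from `A` to `B` into that procedure. -/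
abbrev PS.know {S : ProcSignature.{u}} (A B : Proc S) :
    CI.sys (Proc.rules S) A (A ⟶ B) ⟶ CI.sys (Proc.rules S) B PUnit :=
  CI.know (Proc.readout S) (Proc.rules S) A B

/-- A family of maps from states of knowledge about procedures from `A` to `B` to states of
knowledge about functions from `Λ_A` to `Λ_B`. -/
abbrev KnowledgeMap {S : ProcSignature.{u}} (L : OnticStates S) : Type u :=
  ∀ A B : Proc S, SubStoch (A ⟶ B) (L.ont A ⟶ L.ont B)

namespace KnowledgeMap

variable {S : ProcSignature.{u}} {L : OnticStates S}

/-- Knowledge about a procedure from `A` to `B` is mapped to knowledge about a function from `Λ_A`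
to `Λ_B`, which is then fed into the generator for functions. -/
def natural (Ξ : KnowledgeMap L) (A B : Proc S) :
    CI.sys Func.Rules (L.ont A) (A ⟶ B) ⟶ CI.sys Func.Rules (L.ont B) PUnit :=
  CI.embed Func.Rules (𝟙 (L.ont A)) (Ξ A B) ≫
    CI.know Func.readout Func.Rules (L.ont A) (L.ont B)

/-- The compositionality constraints: compatibility with sequential and parallel composition and
with wiring. -/
structure Compositional (Ξ : KnowledgeMap L) : Prop where
  seq : ∀ A B F : Proc S,
    ((Ξ A B).tensor (Ξ B F)).comp (Diag.seqComp (L.ont A) (L.ont B) (L.ont F)) =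
      (Diag.seqComp A B F).comp (Ξ A F)
  par : ∀ A B A' B' : Proc S,
    ((Ξ A B).tensor (Ξ A' B')).comp
        (Diag.parComp (L.ont A) (L.ont B) (L.ont A') (L.ont B')) =
      (Diag.parComp A B A' B').comp (Ξ (A ⊗ A') (B ⊗ B'))
  id : ∀ A : Proc S, (SubStoch.point (𝟙 A)).comp (Ξ A A) = SubStoch.point (𝟙 (L.ont A))
  associator : ∀ A B F : Proc S, (SubStoch.point (α_ A B F).hom).comp (Ξ _ _) =
    SubStoch.point (α_ (L.ont A) (L.ont B) (L.ont F)).hom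
  leftUnitor : ∀ A : Proc S, (SubStoch.point (λ_ A).hom).comp (Ξ _ _) =
    SubStoch.point (λ_ (L.ont A)).hom
  rightUnitor : ∀ A : Proc S, (SubStoch.point (ρ_ A).hom).comp (Ξ _ _) =
    SubStoch.point (ρ_ (L.ont A)).hom
  braiding : ∀ A B : Proc S, (SubStoch.point (β_ A B).hom).comp (Ξ _ _) =
    SubStoch.point (β_ (L.ont A) (L.ont B)).hom

end KnowledgeMap

end

/-! The realist theory is rigid. `prepare A X` turns knowledge of an ontic state of `A` into a
system in that state. Every generator, hence every process `D`, satisfies `prepare ≫ D = embed s ≫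
prepare` for some substochastic map `s` on ontic and inferential states
(`exists_prepare_comp_diag`). For `learn` this is the rule `know_learn` with trivial input; for
`ignore` it follows from the rule `know_ignore`. Consequently, agreement after preparation
(`AgreeOnStates`) is a congruence. On closed processes it is equality, so it implies inferential
equivalence under every prediction map.

A procedure `t` absorbs ignoring, and `ξ` preserves ignorability, so the map `s` of `ξ(t)` is
stochastic. As ontic state spaces are finite, a stochastic map is the family of marginals of a
random function, for instance with independent values at all arguments
(`SubDist.exists_random_function`). Thus `ξ(t)` agrees on states with a random function
(`exists_embedRandom`).

Such a coupling is not unique, and separate choices for all procedures need not compose. So it is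
chosen only for the primitive procedures. Distributions over functions, composed independently,
satisfy the laws of a symmetric monoidal category, so the freeness of `Proc` extends the choice to
all procedures (`ProcTerm.random`, `KnowledgeMap.ofBoxes`). Compositionality then holds by
construction. Agreement with `ξ` propagates from the primitive procedures because `AgreeOnStates` is
a congruence (`agree_random`), and from certain to arbitrary knowledge because substochastic maps
are determined by their values at points (`agree_know`).

The representation `ξ'` interprets `know` in the natural form and keeps `learn` as in `ξ`. The rules
for `know` follow from compositionality and stochasticity of `Ξ`. The rules for `learn` involve only
parts on which the interpretation equals `ξ` (`interpret_eq_of_rel`). Predictions are preserved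
because agreement of closed processes is equality. -/

noncomputable section

/-! ### Subdistributions as a commutative monad. -/

namespace SubDist

variable {X Y Z : Type u}

theorem bind_pure (d : SubDist X) : d.bind pure = d := by
  ext1
  simp [pure, bind]

theorem bind_assoc (d : SubDist X) (k : X → SubDist Y) (l : Y → SubDist Z) :
    (d.bind k).bind l = d.bind fun x => (k x).bind l := by
  ext1
  simp only [bind]
  rw [Finsupp.sum_sum_index (by simp) (by simp [add_smul])]
  refine Finsupp.sum_congr fun x _ => ?_
  rw [Finsupp.sum_smul_index (by simp), Finsupp.smul_sum]
  simp only [mul_smul]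

/-- Independent draws may be made in either order. The interchange law and the naturality of the
braiding for random processes rest on this. -/
theorem bind_comm (d : SubDist X) (e : SubDist Y) (k : X → Y → SubDist Z) :
    (d.bind fun x => e.bind fun y => k x y) = e.bind fun y => d.bind fun x => k x y := by
  ext1
  simp only [bind, Finsupp.smul_sum]
  rw [Finsupp.sum_comm]
  simp only [smul_smul, mul_comm]

theorem mass_bind (d : SubDist X) {k : X → SubDist Y} (h : ∀ x, (k x).mass = 1) :
    (d.bind k).mass = d.mass := by
  rw [mass, bind, sum_linear]
  refine Finsupp.sum_congr fun x _ => ?_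
  rw [show (k x).weight.sum (fun _ r => r) = 1 from h x, mul_one]

theorem mass_pure (x : X) : (pure x).mass = 1 := by simp [mass, pure]

theorem bind_const (d : SubDist X) (h : d.mass = 1) (e : SubDist Y) :
    (d.bind fun _ => e) = e := by
  ext1
  have h' : (∑ x ∈ d.weight.support, d.weight x) = 1 := h
  simp only [bind, Finsupp.sum]
  rw [← Finset.sum_smul, h', one_smul]

end SubDist

namespace SubStoch

variable {X Y Z X' Y' : Type u}

theorem id_comp (s : SubStoch X Y) : (id X).comp s = s := funext fun x => SubDist.pure_bind x s

theorem comp_id (s : SubStoch X Y) : s.comp (id Y) = s := funext fun x => SubDist.bind_pure (s x)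

theorem id_prod (X Y : Type u) : id (X × Y) = (id X).tensor (id Y) :=
  (det_tensor_det (fun x : X => x) fun y : Y => y).symm

/-- A family of subdistributions, as a substochastic map. -/
def ofFun (f : X → SubDist Y) : SubStoch X Y := f

theorem ofFun_apply (f : X → SubDist Y) (x : X) : ofFun f x = f x := rfl

theorem id_apply (x : X) : id X x = SubDist.pure x := rfl

theorem det_apply (f : X → Y) (x : X) : det f x = SubDist.pure (f x) := rfl

theorem comp_apply (s : SubStoch X Y) (t : SubStoch Y Z) (x : X) :
    s.comp t x = (s x).bind fun y => t y := rfl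

theorem tensor_apply (s : SubStoch X Y) (t : SubStoch X' Y') (x : X × X') :
    s.tensor t x = (s x.1).bind fun y => (t x.2).bind fun y' => SubDist.pure (y, y') := rfl

theorem point_apply (x : X) (i : PUnit.{u + 1}) : point x i = SubDist.pure x := rfl

theorem discard_apply (x : X) : discard X x = SubDist.pure PUnit.unit := rfl

end SubStoch

attribute [local simp] SubDist.pure_bind SubDist.bind_pure SubDist.bind_assoc SubStoch.id_apply
  SubStoch.ofFun_apply SubStoch.det_apply SubStoch.comp_apply SubStoch.tensor_apply SubStoch.point_apply
  SubStoch.discard_apply Diag.seqComp Diag.parComp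

/-! ### Spectator systems and random knowledge in an arbitrary causal-inferential theory. -/

namespace CI
variable {C : Type w} [Category.{u} C] [MonoidalCategory.{u} C] [SymmetricCategory.{u} C]
variable {K : Readout.{u} C} {R : ∀ P Q : CISys.{u} C, Diag K P Q → Diag K P Q → Prop}
variable {A B F A' B' F' A'' B'' : C} {X Y Z X' Y' Z' X'' Y'' : Type u}

theorem embed_comp_assoc (t : A ⟶ B) (t' : B ⟶ F) (s : SubStoch X Y)
    (s' : SubStoch Y Z) {T : CI K R} (D : sys R F Z ⟶ T) :
    embed R t s ≫ embed R t' s' ≫ D = embed R (t ≫ t') (s.comp s') ≫ D := by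
  rw [← Category.assoc, embed_comp]

/-- Parallel composition, with the components of the composite systems made explicit. -/
def par (D : sys R A X ⟶ sys R B Y) (E : sys R A' X' ⟶ sys R B' Y') :
    sys R (A ⊗ A') (X × X') ⟶ sys R (B ⊗ B') (Y × Y') := D ⊗ₘ E

theorem par_comp (D : sys R A X ⟶ sys R B Y) (E : sys R B Y ⟶ sys R F Z)
    (D' : sys R A' X' ⟶ sys R B' Y') (E' : sys R B' Y' ⟶ sys R F' Z') :
    par D D' ≫ par E E' = par (D ≫ E) (D' ≫ E') :=
  MonoidalCategory.tensorHom_comp_tensorHom _ _ _ _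

theorem par_comp_assoc (D : sys R A X ⟶ sys R B Y) (E : sys R B Y ⟶ sys R F Z)
    (D' : sys R A' X' ⟶ sys R B' Y') (E' : sys R B' Y' ⟶ sys R F' Z') {T : CI K R}
    (G : sys R (F ⊗ F') (Z × Z') ⟶ T) :
    par D D' ≫ par E E' ≫ G = par (D ≫ E) (D' ≫ E') ≫ G := by
  rw [← Category.assoc, par_comp]

theorem embed_par (t : A ⟶ B) (s : SubStoch X Y) (t' : A' ⟶ B') (s' : SubStoch X' Y') :
    par (embed R t s) (embed R t' s') = embed R (t ⊗ₘ t') (s.tensor s') :=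
  embed_tensor t s t' s'

theorem id_eq_embed (A : C) (X : Type u) : 𝟙 (sys R A X) = embed R (𝟙 A) (SubStoch.id X) :=
  (embed_id A X).symm

theorem embed_det_id (A : C) (X : Type u) :
    embed R (𝟙 A) (SubStoch.det fun x : X => x) = 𝟙 (sys R A X) := embed_id A X

theorem par_assoc (D : sys R A X ⟶ sys R A' X') (E : sys R B Y ⟶ sys R B' Y')
    (G : sys R F Z ⟶ sys R F' Z') :
    par (par D E) G ≫ embed R (α_ A' B' F').hom (SubStoch.det (Equiv.prodAssoc X' Y' Z')) =
      embed R (α_ A B F).hom (SubStoch.det (Equiv.prodAssoc X Y Z)) ≫ par D (par E G) :=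
  MonoidalCategory.associator_naturality D E G

theorem par_unit (D : sys R A X ⟶ sys R B Y) :
    par D (𝟙 (sys R (𝟙_ C) PUnit)) ≫ embed R (ρ_ B).hom (SubStoch.det Prod.fst) =
      embed R (ρ_ A).hom (SubStoch.det Prod.fst) ≫ D := by
  rcases D with ⟨D⟩
  exact Quot.sound (.right_natural D)

theorem embed_tensorμ (A B A' B' : C) (X Y X' Y' : Type u) :
    tensorμ (sys R A X) (sys R B Y) (sys R A' X') (sys R B' Y') =
      embed R (tensorμ A B A' B')
        (SubStoch.det fun x : (X × Y) × (X' × Y') => ((x.1.1, x.2.1), (x.1.2, x.2.2))) := by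
  simp only [tensorμ, ← MonoidalCategory.tensorHom_id, ← MonoidalCategory.id_tensorHom]
  change embed R (α_ A B (A' ⊗ B')).hom (SubStoch.det (Equiv.prodAssoc X Y (X' × Y'))) ≫
    par (𝟙 (sys R A X)) (embed R (α_ B A' B').inv (SubStoch.det (Equiv.prodAssoc Y X' Y').symm)) ≫
    par (𝟙 (sys R A X)) (par (embed R (β_ B A').hom (SubStoch.det (Equiv.prodComm Y X')))
      (𝟙 (sys R B' Y'))) ≫
    par (𝟙 (sys R A X)) (embed R (α_ A' B B').hom (SubStoch.det (Equiv.prodAssoc X' Y Y'))) ≫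
    embed R (α_ A A' (B ⊗ B')).inv (SubStoch.det (Equiv.prodAssoc X X' (Y × Y')).symm) = _
  rw [id_eq_embed, id_eq_embed]
  simp only [embed_par, embed_comp]
  simp only [SubStoch.id, SubStoch.det_tensor_det, SubStoch.det_comp_det]
  rfl

/-- Naturality of the middle-four exchange `tensorμ`, which by `embed_tensorμ` is embedded wiring.
-/
theorem par_interchange (D : sys R A X ⟶ sys R B Y) (E : sys R A' X' ⟶ sys R B' Y')
    (D' : sys R F Z ⟶ sys R F' Z') (E' : sys R A'' X'' ⟶ sys R B'' Y'') :
    par (par D E) (par D' E') ≫ embed R (tensorμ B B' F' B'')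
        (SubStoch.det fun x : (Y × Y') × (Z' × Y'') => ((x.1.1, x.2.1), (x.1.2, x.2.2))) =
      embed R (tensorμ A A' F A'')
        (SubStoch.det fun x : (X × X') × (Z × X'') => ((x.1.1, x.2.1), (x.1.2, x.2.2))) ≫
        par (par D D') (par E E') := by
  rw [← embed_tensorμ, ← embed_tensorμ]
  exact tensorμ_natural D E D' E'

/-- A process next to a spectator inferential system `Z`. -/
def beside (D : sys R A X ⟶ sys R B Y) (Z : Type u) : sys R A (X × Z) ⟶ sys R B (Y × Z) :=
  embed R (ρ_ A).inv (SubStoch.id (X × Z)) ≫ par D (𝟙 (sys R (𝟙_ C) Z)) ≫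
    embed R (ρ_ B).hom (SubStoch.id (Y × Z))


theorem beside_comp (D : sys R A X ⟶ sys R B Y) (E : sys R B Y ⟶ sys R F Z) (T : Type u) :
    beside (D ≫ E) T = beside D T ≫ beside E T := by
  simp only [beside, Category.assoc]
  rw [embed_comp_assoc, Iso.hom_inv_id, SubStoch.id_comp, ← id_eq_embed, Category.id_comp,
    par_comp_assoc, Category.id_comp]

theorem beside_embed (t : A ⟶ B) (s : SubStoch X Y) (Z : Type u) :
    beside (embed R t s) Z = embed R t (s.tensor (SubStoch.id Z)) := by
  rw [beside, id_eq_embed, embed_par, embed_comp, embed_comp, SubStoch.id_comp, SubStoch.comp_id]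
  simp

/-- The interchange law: what happens to the spectator may happen before or after `D`. -/
theorem beside_slide (D : sys R A X ⟶ sys R B Y) (s : SubStoch Z Z') :
    beside D Z ≫ embed R (𝟙 B) ((SubStoch.id Y).tensor s) =
      embed R (𝟙 A) ((SubStoch.id X).tensor s) ≫ beside D Z' := by
  have h : par D (𝟙 (sys R (𝟙_ C) Z)) ≫
        embed R (𝟙 B ⊗ₘ 𝟙 (𝟙_ C)) ((SubStoch.id Y).tensor s) =
      embed R (𝟙 A ⊗ₘ 𝟙 (𝟙_ C)) ((SubStoch.id X).tensor s) ≫ par D (𝟙 (sys R (𝟙_ C) Z')) := by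
    rw [← embed_par, ← embed_par, par_comp, par_comp, ← id_eq_embed, ← id_eq_embed]
    simp
  rw [beside, Category.assoc, Category.assoc, embed_comp, Category.comp_id, SubStoch.id_comp]
  rw [← SubStoch.comp_id ((SubStoch.id Y).tensor s), ← Category.id_comp (ρ_ B).hom, ← embed_comp]
  rw [MonoidalCategory.id_tensorHom_id, MonoidalCategory.id_tensorHom_id] at h
  rw [reassoc_of% h, beside, embed_comp_assoc, embed_comp_assoc, SubStoch.id_comp,
    SubStoch.comp_id, Category.comp_id, Category.id_comp]

theorem beside_punit (D : sys R A X ⟶ sys R B Y) :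
    beside D PUnit.{u + 1} =
      embed R (𝟙 A) (SubStoch.det Prod.fst) ≫ D ≫
        embed R (𝟙 B) (SubStoch.det fun y => (y, PUnit.unit)) := by
  have h := par_unit D
  rw [beside, ← SubStoch.id_comp (SubStoch.det Prod.fst), ← Iso.inv_hom_id (ρ_ A), ← embed_comp,
    Category.assoc, reassoc_of% h.symm, embed_comp, SubStoch.det_comp_det, Category.comp_id]
  rfl

/-- Two spectators form one once their trivial causal parts are absorbed. This step is common to
`beside_beside` and `par_beside_beside`, which differ only in the wiring that brings the spectators
together. -/
theorem par_id_id_unitors (D : sys R A X ⟶ sys R B Y) (Z T : Type u) :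
    par D (par (𝟙 (sys R (𝟙_ C) Z)) (𝟙 (sys R (𝟙_ C) T))) ≫
        embed R ((𝟙 B ⊗ₘ (λ_ (𝟙_ C)).hom) ≫ (ρ_ B).hom) (SubStoch.id (Y × Z × T)) =
      embed R ((𝟙 A ⊗ₘ (λ_ (𝟙_ C)).hom) ≫ (ρ_ A).hom) (SubStoch.id (X × Z × T)) ≫
        beside D (Z × T) := by
  rw [beside, embed_comp_assoc, Category.assoc, Iso.hom_inv_id, Category.comp_id, SubStoch.id_comp]
  rw [← SubStoch.id_comp (SubStoch.id (Y × Z × T)), ← embed_comp]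
  rw [SubStoch.id_prod Y, SubStoch.id_prod X, ← embed_par, ← embed_par, par_comp_assoc, par_comp_assoc, ← id_eq_embed,
    ← id_eq_embed, Category.comp_id, Category.id_comp, Category.comp_id]
  rw [id_eq_embed, id_eq_embed, embed_par, embed_comp]
  simp only [← SubStoch.id_prod, SubStoch.id_comp, MonoidalCategory.id_tensorHom_id, Category.id_comp]

theorem beside_beside (D : sys R A X ⟶ sys R B Y) (Z T : Type u) :
    beside (beside D Z) T ≫ embed R (𝟙 B) (SubStoch.det (Equiv.prodAssoc Y Z T)) =
      embed R (𝟙 A) (SubStoch.det (Equiv.prodAssoc X Z T)) ≫ beside D (Z × T) := by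
  have h := par_assoc D (𝟙 (sys R (𝟙_ C) Z)) (𝟙 (sys R (𝟙_ C) T))
  have h' := par_id_id_unitors D Z T
  have e : par (beside D Z) (𝟙 (sys R (𝟙_ C) T)) =
      embed R ((ρ_ A).inv ⊗ₘ 𝟙 (𝟙_ C)) (SubStoch.id ((X × Z) × T)) ≫
        par (par D (𝟙 (sys R (𝟙_ C) Z))) (𝟙 (sys R (𝟙_ C) T)) ≫
          embed R ((ρ_ B).hom ⊗ₘ 𝟙 (𝟙_ C)) (SubStoch.id ((Y × Z) × T)) := by
    rw [SubStoch.id_prod _ T, SubStoch.id_prod _ T, ← embed_par, ← embed_par, par_comp, par_comp, ← id_eq_embed,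
      Category.id_comp, Category.comp_id]
    rfl
  have t (A : C) : ((ρ_ A).hom ⊗ₘ 𝟙 (𝟙_ C)) ≫ (ρ_ A).hom =
      (α_ A (𝟙_ C) (𝟙_ C)).hom ≫ (𝟙 A ⊗ₘ (λ_ (𝟙_ C)).hom) ≫ (ρ_ A).hom := by simp
  rw [beside, e]
  simp only [Category.assoc, embed_comp, embed_comp_assoc, SubStoch.id_comp, Category.comp_id]
  rw [t, ← SubStoch.comp_id (SubStoch.det (Equiv.prodAssoc Y Z T)), ← embed_comp, reassoc_of% h, h',
    embed_comp_assoc, embed_comp_assoc]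
  congr 2
  · rw [Category.assoc, Category.assoc, ← t, MonoidalCategory.tensorHom_comp_tensorHom_assoc]
    simp
  · simp only [SubStoch.id_comp, SubStoch.comp_id]

theorem beside_prod (D : sys R A X ⟶ sys R B Y) (Z T : Type u) :
    beside D (Z × T) ≫ embed R (𝟙 B) (SubStoch.det (Equiv.prodAssoc Y Z T).symm) =
      embed R (𝟙 A) (SubStoch.det (Equiv.prodAssoc X Z T).symm) ≫ beside (beside D Z) T := by
  have h := congrArg (fun E => embed R (𝟙 A) (SubStoch.det (Equiv.prodAssoc X Z T).symm) ≫ E ≫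
    embed R (𝟙 B) (SubStoch.det (Equiv.prodAssoc Y Z T).symm)) (beside_beside D Z T)
  simpa [embed_comp, embed_comp_assoc, SubStoch.det_comp_det, embed_det_id]
    using h.symm

theorem par_beside_beside (D : sys R A X ⟶ sys R B Y) (E : sys R A' X' ⟶ sys R B' Y')
    (Z T : Type u) :
    par (beside D Z) (beside E T) ≫ embed R (𝟙 (B ⊗ B'))
        (SubStoch.det fun x : (Y × Z) × (Y' × T) => ((x.1.1, x.2.1), (x.1.2, x.2.2))) =
      embed R (𝟙 (A ⊗ A'))
        (SubStoch.det fun x : (X × Z) × (X' × T) => ((x.1.1, x.2.1), (x.1.2, x.2.2))) ≫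
          beside (par D E) (Z × T) := by
  have h := par_interchange D (𝟙 (sys R (𝟙_ C) Z)) E (𝟙 (sys R (𝟙_ C) T))
  have h' := par_id_id_unitors (par D E) Z T
  have e : par (beside D Z) (beside E T) =
      embed R ((ρ_ A).inv ⊗ₘ (ρ_ A').inv) (SubStoch.id ((X × Z) × (X' × T))) ≫
        par (par D (𝟙 (sys R (𝟙_ C) Z))) (par E (𝟙 (sys R (𝟙_ C) T))) ≫
          embed R ((ρ_ B).hom ⊗ₘ (ρ_ B').hom) (SubStoch.id ((Y × Z) × (Y' × T))) := by
    rw [SubStoch.id_prod (X × Z), SubStoch.id_prod (Y × Z), ← embed_par, ← embed_par, par_comp, par_comp]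
    rfl
  have t (A B : C) : (ρ_ A).hom ⊗ₘ (ρ_ B).hom =
      tensorμ A (𝟙_ C) B (𝟙_ C) ≫ (𝟙 (A ⊗ B) ⊗ₘ (λ_ (𝟙_ C)).hom) ≫ (ρ_ (A ⊗ B)).hom := by
    rw [rightUnitor_monoidal, MonoidalCategory.id_tensorHom]
  rw [e]
  simp only [Category.assoc, embed_comp, SubStoch.id_comp, Category.comp_id]
  rw [t, ← SubStoch.comp_id (SubStoch.det _), ← embed_comp, reassoc_of% h, h',
    embed_comp_assoc, embed_comp_assoc]
  congr 2
  · rw [Category.assoc, ← t, MonoidalCategory.tensorHom_comp_tensorHom]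
    simp
  · simp only [SubStoch.id_comp, SubStoch.comp_id]

theorem know_seq (A B F : C) :
    beside (know K R A B) (B ⟶ F) ≫ embed R (𝟙 B) (SubStoch.det Prod.snd) ≫ know K R B F =
      embed R (𝟙 A) (Diag.seqComp A B F) ≫ know K R A F :=
  Quot.sound (.know_seq A B F)

theorem know_par (A B A' B' : C) :
    par (know K R A B) (know K R A' B') ≫ embed R (𝟙 (B ⊗ B')) (SubStoch.discard _) =
      embed R (𝟙 (A ⊗ A')) (Diag.parComp A B A' B') ≫ know K R (A ⊗ A') (B ⊗ B') :=
  Quot.sound (.know_par A B A' B')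

theorem embed_know (t : A ⟶ B) :
    embed R t (SubStoch.id PUnit.{u + 1}) =
      embed R (𝟙 A) (SubStoch.point t) ≫ know K R A B :=
  Quot.sound (.embed_know t)

/-- The process obtained by feeding a process with random knowledge `r` of it, correlated with an
inferential process. -/
def feed (r : SubStoch X ((A ⟶ B) × Y)) : sys R A X ⟶ sys R B Y :=
  embed R (𝟙 A) r ≫ beside (know K R A B) Y ≫ embed R (𝟙 B) (SubStoch.det Prod.snd)

theorem know_eq_feed (A B : C) :
    know K R A B = feed (SubStoch.det fun f => (f, PUnit.unit)) := by
  rw [feed, beside_punit]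
  simp only [Category.assoc, embed_comp, embed_comp_assoc, SubStoch.det_comp_det, Category.comp_id]
  rw [embed_det_id]
  erw [embed_det_id]
  simp


/-- The rule `embed_know` in the presence of a spectator `Y`. Together with `know_eq_feed` it brings
causal processes and knowledge of them into the common form `feed`. -/
theorem embed_eq_feed (t : A ⟶ B) (s : SubStoch X Y) :
    embed R t s = feed (SubStoch.ofFun fun x => (s x).bind fun y => SubDist.pure (t, y)) := by
  have h := congrArg (fun D => beside D Y) (embed_know (K := K) (R := R) t)
  simp only [beside_comp, beside_embed] at h
  have e : (SubStoch.ofFun fun x => (s x).bind fun y => SubDist.pure (t, y)) =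
      (s.comp (SubStoch.det fun y => (PUnit.unit.{u + 1}, y))).comp
        ((SubStoch.point t).tensor (SubStoch.id Y)) := by
    funext x
    simp
  unfold feed
  rw [e, ← Category.id_comp (𝟙 A), ← embed_comp, Category.assoc, ← reassoc_of% h]
  simp only [embed_comp, Category.id_comp, Category.comp_id]
  congr 1
  funext x
  simp

/-- The source `r'` of the second process acts on a spectator of the first `know`, so it slides in
front of it. All knowledge is then available at the start, and `know_seq` merges the two generators.
-/
theorem feed_comp (r : SubStoch X ((A ⟶ B) × Y)) (r' : SubStoch Y ((B ⟶ F) × Z)) :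
    feed (K := K) (R := R) r ≫ feed r' =
      feed (SubStoch.ofFun fun x => (r x).bind fun a => (r' a.2).bind fun b => SubDist.pure (a.1 ≫ b.1, b.2)) := by
  have h := congrArg (fun D => beside D Z) (know_seq (K := K) (R := R) A B F)
  simp only [beside_comp, beside_embed] at h
  have e : (SubStoch.det Prod.snd : SubStoch (PUnit.{u + 1} × Y) Y).comp r' =
      (((SubStoch.id _).tensor r').comp (SubStoch.det (Equiv.prodAssoc _ _ _).symm)).comp
        ((SubStoch.det Prod.snd).tensor (SubStoch.id Z)) := by
    funext x
    simp
  simp only [feed, Category.assoc, embed_comp_assoc]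
  rw [e, ← Category.comp_id (𝟙 B ≫ 𝟙 B), ← embed_comp, ← embed_comp, Category.assoc, Category.assoc]
  rw [reassoc_of% (beside_slide (know K R A B) r'), reassoc_of% (beside_prod (know K R A B) (B ⟶ F) Z),
    reassoc_of% h]
  simp only [embed_comp_assoc, Category.comp_id]
  congr 2
  funext x
  simp

/-- Once the spectators are gathered on one side by `par_beside_beside`, the rule `know_par`
applies. -/
theorem feed_par (r : SubStoch X ((A ⟶ B) × Y)) (r' : SubStoch X' ((A' ⟶ B') × Y')) :
    par (feed (K := K) (R := R) r) (feed r') =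
      feed (SubStoch.ofFun fun x => (r x.1).bind fun a => (r' x.2).bind fun b =>
        SubDist.pure (a.1 ⊗ₘ b.1, (a.2, b.2))) := by
  have h := congrArg (fun D => beside D (Y × Y')) (know_par (K := K) (R := R) A B A' B')
  simp only [beside_comp, beside_embed] at h
  have h' := par_beside_beside (know K R A B) (know K R A' B') Y Y'
  have e : (SubStoch.det Prod.snd : SubStoch (PUnit.{u + 1} × Y) Y).tensor
        (SubStoch.det Prod.snd : SubStoch (PUnit.{u + 1} × Y') Y') =
      ((SubStoch.det fun x => ((x.1.1, x.2.1), (x.1.2, x.2.2))).comp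
        ((SubStoch.discard _).tensor (SubStoch.id _))).comp (SubStoch.det Prod.snd) := by
    funext x
    simp
  simp only [feed, ← par_comp, embed_par]
  rw [e, ← Category.comp_id (𝟙 B ⊗ₘ 𝟙 B'), ← Category.comp_id (𝟙 B ⊗ₘ 𝟙 B'), ← embed_comp,
    ← embed_comp]
  simp only [MonoidalCategory.id_tensorHom_id, Category.assoc]
  rw [reassoc_of% h', reassoc_of% h]
  simp only [embed_comp_assoc, Category.comp_id]
  congr 2
  funext x
  simp

end CI

/-! ### Prepared ontic states in the realist theory, and agreement on them. -/

namespace Func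
open CI

variable {A B A' B' : Func.{u}} {X Y X' Y' : Type u}

/-- The point of a set of ontic states, as a process. -/
def const (a : A.carrier) : 𝟙_ Func.{u} ⟶ A := ofFun fun _ => a

/-- The preparation of a known ontic state. -/
def prepare (A : Func.{u}) (X : Type u) :
    sys Rules.{u} (𝟙_ Func.{u}) (A.carrier × X) ⟶ sys Rules A X :=
  feed (SubStoch.det fun x => (const x.1, x.2))

/-- A constant function followed by `f` is the constant function at the value of `f`, so both sides
are the same `feed` of random constants. -/
theorem prepare_feed (r : SubStoch X ((A ⟶ B) × Y)) :
    prepare A X ≫ feed r =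
      embed Rules (𝟙 _) (SubStoch.ofFun fun x => (r x.2).bind fun a => SubDist.pure (Hom.toFun a.1 x.1, a.2)) ≫
        prepare B Y := by
  rw [prepare, prepare, embed_eq_feed, feed_comp, feed_comp]
  congr 1
  funext x
  simp
  rfl

theorem prepare_embed (f : A ⟶ B) (s : SubStoch X Y) :
    prepare A X ≫ embed Rules f s =
      embed Rules (𝟙 _) ((SubStoch.det (Hom.toFun f)).tensor s) ≫ prepare B Y := by
  rw [embed_eq_feed, prepare_feed]
  congr 2
  funext x
  simp

/-- Regrouping ontic states and inferential systems of a composite system. -/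
def shuffle (A B : Func.{u}) (X Y : Type u) :
    SubStoch ((A.carrier × X) × (B.carrier × Y)) ((A ⊗ B : Func.{u}).carrier × (X × Y)) :=
  SubStoch.det fun x => ((x.1.1, x.2.1), (x.1.2, x.2.2))

/-- The inverse of `shuffle`. -/
def unshuffle (A B : Func.{u}) (X Y : Type u) :
    SubStoch ((A ⊗ B : Func.{u}).carrier × (X × Y)) ((A.carrier × X) × (B.carrier × Y)) :=
  SubStoch.det fun x => ((x.1.1, x.2.1), (x.1.2, x.2.2))

theorem unshuffle_comp_shuffle (A B : Func.{u}) (X Y : Type u) :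
    (unshuffle A B X Y).comp (shuffle A B X Y) = SubStoch.id _ := SubStoch.det_comp_det _ _

theorem par_prepare (A B : Func.{u}) (X Y : Type u) :
    par (prepare A X) (prepare B Y) =
      embed Rules (λ_ (𝟙_ Func.{u})).hom
        (shuffle A B X Y) ≫
        prepare (A ⊗ B) (X × Y) := by
  rw [prepare, prepare, prepare, feed_par, embed_eq_feed, feed_comp]
  congr 1
  funext x
  simp [shuffle]
  rfl

/-- Ignoring the trivial system does nothing, so `know_ignore` for functions into the singleton
identifies feeding in the unique such function with ignoring its input. -/
theorem ignore_eq_embed (A : Func.{u}) :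
    ignore readout Rules A =
      embed Rules (ofFun fun _ => PUnit.unit : A ⟶ 𝟙_ Func.{u}) (SubStoch.id PUnit) := by
  have h : know readout Rules A (𝟙_ Func.{u}) ≫ ignore readout Rules (𝟙_ Func.{u}) =
      embed Rules (𝟙 A) (SubStoch.discard _) ≫ ignore readout Rules A :=
    Quot.sound (.know_ignore A _)
  have h₁ : ignore readout Rules (𝟙_ Func.{u}) = 𝟙 _ := Quot.sound .ignore_unit
  rw [embed_know]
  rw [h₁, Category.comp_id] at h
  rw [h, embed_comp_assoc]
  have e : (SubStoch.point (ofFun fun _ => PUnit.unit : A ⟶ 𝟙_ Func.{u})).comp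
      (SubStoch.discard _) = SubStoch.id PUnit := by
    funext x; simp
  rw [e, Category.comp_id, embed_id, Category.id_comp]

/-- Learning the ontic state of a system. -/
def observe (A : Func.{u}) : sys Rules A PUnit.{u + 1} ⟶ sys Rules A A.carrier :=
  learn readout Rules A trivial

/-- The state of the trivial system. -/
def unitState : SubStoch PUnit.{u + 1} (𝟙_ Func.{u}).carrier := SubStoch.det fun _ => PUnit.unit

/-- The trivial system has one state, so discarding what was learned is invertible and
`learn_discard` determines the process. -/
theorem observe_unit :
    observe (𝟙_ Func.{u}) =
      embed Rules (𝟙 _) unitState := by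
  have h : observe (𝟙_ Func.{u}) ≫ embed Rules (𝟙 _) (SubStoch.discard _) = 𝟙 _ :=
    Quot.sound (.learn_discard _ _)
  have e := congrArg (fun E => E ≫ embed Rules (𝟙 (𝟙_ Func.{u}))
    unitState) h
  simp only [Category.assoc, embed_comp, Category.id_comp] at e
  rw [← e]
  have h' : (SubStoch.discard (𝟙_ Func.{u}).carrier).comp unitState = SubStoch.id _ :=
    SubStoch.det_comp_det _ _
  rw [h', embed_id, Category.comp_id]

theorem know_observe (A B : Func.{u}) :
    know readout Rules A B ≫ observe B =
      embed Rules (𝟙 A) (SubStoch.det fun f : A ⟶ B => (PUnit.unit, (f, f))) ≫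
        beside (observe A) ((A ⟶ B) × (A ⟶ B)) ≫
        embed Rules (𝟙 A) (SubStoch.det
          fun x : A.carrier × (A ⟶ B) × (A ⟶ B) => (x.2.1, (x.2.2, x.1))) ≫
        beside (know readout Rules A B) ((A ⟶ B) × A.carrier) ≫
        embed Rules (𝟙 B) (SubStoch.det Prod.snd) ≫ embed Rules (𝟙 B) (apply A B) :=
  Quot.sound (.extra (.know_learn A B))

/-- A preparation is a function from the trivial system. There, the input side of `know_learn` is
trivial by `observe_unit`, and the rule returns a copy of the value of the function, which is the
prepared state. -/
theorem prepare_observe (A : Func.{u}) :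
    prepare A PUnit ≫ observe A =
      embed Rules (𝟙 _) (SubStoch.det fun x : A.carrier × PUnit => (x.1, x.1)) ≫
        prepare A A.carrier := by
  have h := know_observe (𝟙_ Func.{u}) A
  have hf {Z Y : Type u} (r : SubStoch Z ((𝟙_ Func.{u} ⟶ A) × Y)) {T : FS.{u}}
      (G : sys Rules A Y ⟶ T) :
      embed Rules (𝟙 _) r ≫ beside (know readout Rules (𝟙_ Func.{u}) A) Y ≫
        embed Rules (𝟙 A) (SubStoch.det Prod.snd) ≫ G = feed r ≫ G := by
    simp only [feed, Category.assoc]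
  have e : prepare A PUnit = embed Rules (𝟙 _)
      (SubStoch.det fun x : A.carrier × PUnit => const x.1) ≫
        know readout Rules (𝟙_ Func.{u}) A := by
    rw [know_eq_feed, embed_eq_feed, feed_comp, prepare]
    congr 1
    funext x
    simp
  rw [e, Category.assoc, h, observe_unit, beside_embed, embed_comp_assoc, embed_comp_assoc,
    embed_comp_assoc, Category.id_comp, Category.id_comp, Category.id_comp,
    hf, prepare, embed_eq_feed, embed_eq_feed, feed_comp, feed_comp]
  congr 1
  funext x
  simp [apply, unitState]
  exact SubDist.pure_bind _ _

/-- Preparations move through each generator and leave a purely inferential process in front. On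
prepared states, a process of the realist theory is therefore a substochastic map. -/
theorem exists_prepare_comp_diag {P Q : CISys.{u} Func.{u}} (D : Diag readout P Q) :
    ∃ s : SubStoch (P.caus.carrier × P.inf) (Q.caus.carrier × Q.inf),
      prepare P.caus P.inf ≫ (Quot.mk _ D : sys Rules P.caus P.inf ⟶ sys Rules Q.caus Q.inf) =
        embed Rules (𝟙 _) s ≫ prepare Q.caus Q.inf := by
  induction D with
  | id P =>
    refine ⟨SubStoch.id _, ?_⟩
    rw [embed_id, Category.id_comp]
    exact Category.comp_id _
  | comp D E hD hE =>
    obtain ⟨s, hs⟩ := hD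
    obtain ⟨t, ht⟩ := hE
    refine ⟨s.comp t, ?_⟩
    rw [← Category.comp_id (𝟙 _), ← embed_comp, Category.assoc, ← ht, reassoc_of% hs.symm]
    rfl
  | @par P Q P' Q' D E hD hE =>
    obtain ⟨s, hs⟩ := hD
    obtain ⟨t, ht⟩ := hE
    have h := par_comp (prepare P.caus P.inf)
      (Quot.mk _ D : sys Rules P.caus P.inf ⟶ sys Rules Q.caus Q.inf)
      (prepare P'.caus P'.inf)
      (Quot.mk _ E : sys Rules P'.caus P'.inf ⟶ sys Rules Q'.caus Q'.inf)
    rw [hs, ht, ← par_comp, par_prepare, par_prepare, embed_par, embed_comp_assoc, Category.assoc]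
      at h
    -- Preparing a composite is preparing its parts up to `shuffle` and a unitor, both invertible;
    -- precomposing with the inverses isolates the preparation of the composite.
    have h' := congrArg
      (fun G => embed Rules (λ_ (𝟙_ Func.{u})).inv (unshuffle P.caus P'.caus P.inf P'.inf) ≫ G) h
    simp only [embed_comp_assoc, unshuffle_comp_shuffle] at h'
    rw [Iso.inv_hom_id, embed_id, Category.id_comp] at h'
    exact ⟨_, h'⟩
  | embed f s => exact ⟨_, prepare_embed f s⟩
  | know A B => 
    have h := know_eq_feed (K := readout) (R := Rules) A B
    refine ⟨_, (congrArg _ h).trans (prepare_feed _)⟩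
  | learn A _ => exact ⟨_, prepare_observe A⟩
  | ignore A => exact ⟨_, (congrArg _ (ignore_eq_embed A)).trans (prepare_embed _ _)⟩

/-- The preparation of known states of all parts of a system. -/
def prepareSys (P : FS.{u}) : sys Rules.{u} (𝟙_ Func.{u}) (P.caus.carrier × P.inf) ⟶ P :=
  prepare P.caus P.inf

theorem exists_prepareSys_comp {P Q : FS.{u}} (D : P ⟶ Q) :
    ∃ s : SubStoch (P.caus.carrier × P.inf) (Q.caus.carrier × Q.inf),
      prepareSys P ≫ D = embed Rules (𝟙 _) s ≫ prepareSys Q := by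
  rcases D with ⟨D⟩
  exact exists_prepare_comp_diag D

theorem prepare_unit (X : Type u) :
    prepare (𝟙_ Func.{u}) X = embed Rules (𝟙 _) (SubStoch.det Prod.snd) := by
  rw [prepare, embed_eq_feed]
  congr 1
  funext x
  simp
  rfl


theorem prepare_tensor (A B : Func.{u}) (X Y : Type u) :
    prepare (A ⊗ B) (X × Y) =
      embed Rules (λ_ (𝟙_ Func.{u})).inv (unshuffle A B X Y) ≫ par (prepare A X) (prepare B Y) := by
  rw [par_prepare, embed_comp_assoc, unshuffle_comp_shuffle, Iso.inv_hom_id, embed_id,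
    Category.id_comp]

/-- Two processes of the realist theory agree on all prepared ontic states. -/
def AgreeOnStates {P Q : FS.{u}} (D E : P ⟶ Q) : Prop :=
  prepareSys P ≫ D = prepareSys P ≫ E

namespace AgreeOnStates

theorem refl {P Q : FS.{u}} (D : P ⟶ Q) : AgreeOnStates D D := rfl

theorem comp {P Q T : FS.{u}} {D E : P ⟶ Q} {D' E' : Q ⟶ T} (h : AgreeOnStates D E)
    (h' : AgreeOnStates D' E') : AgreeOnStates (D ≫ D') (E ≫ E') := by
  -- The output of `E` on prepared states is again prepared, so the hypothesis on `D'` and `E'`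
  -- becomes applicable.
  obtain ⟨s, hs⟩ := exists_prepareSys_comp E
  rw [AgreeOnStates] at *
  rw [reassoc_of% h, reassoc_of% hs, h', ← Category.assoc, ← hs, Category.assoc]

theorem par {D E : sys Rules A X ⟶ sys Rules B Y} {D' E' : sys Rules A' X' ⟶ sys Rules B' Y'}
    (h : AgreeOnStates D E) (h' : AgreeOnStates D' E') :
    AgreeOnStates (CI.par D D') (CI.par E E') := by
  change prepare (A ⊗ A') (X × X') ≫ _ = prepare (A ⊗ A') (X × X') ≫ _
  have h₁ : prepare A X ≫ D = prepare A X ≫ E := h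
  have h₂ : prepare A' X' ≫ D' = prepare A' X' ≫ E' := h'
  rw [prepare_tensor, Category.assoc, Category.assoc, par_comp, par_comp, h₁, h₂]

theorem tensor {P Q P' Q' : FS.{u}} {D E : P ⟶ Q} {D' E' : P' ⟶ Q'} (h : AgreeOnStates D E)
    (h' : AgreeOnStates D' E') : AgreeOnStates (D ⊗ₘ D') (E ⊗ₘ E') := par h h'

/-- Preparing the trivial system is a split epimorphism, with section the preparation's only
possible input state, so it can be cancelled. -/
theorem eq_of_closed {D E : sys Rules (𝟙_ Func.{u}) X ⟶ sys Rules (𝟙_ Func.{u}) Y}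
    (h : AgreeOnStates D E) : D = E := by
  have h₁ : prepare (𝟙_ Func.{u}) X ≫ D = prepare (𝟙_ Func.{u}) X ≫ E := h
  have e : embed Rules (𝟙 (𝟙_ Func.{u}))
      (SubStoch.det (Y := (𝟙_ Func.{u}).carrier × X) fun x : X => (PUnit.unit, x)) ≫
        prepare (𝟙_ Func.{u}) X = 𝟙 _ := by
    rw [prepare_unit, embed_comp, SubStoch.det_comp_det, Category.id_comp]
    exact embed_det_id _ _
  rw [← Category.id_comp D, ← e, Category.assoc, h₁, ← Category.assoc, e, Category.id_comp]

/-- A tester turns agreeing processes into agreeing closed processes, and these are equal before any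
prediction is made. -/
theorem inferentiallyEquivalent (q : RealistPredictions.{u}) {P Q : FS.{u}} {D E : P ⟶ Q}
    (h : AgreeOnStates D E) : InferentiallyEquivalent q D E := fun W _ _ x y =>
  congrArg q.map (((refl x).comp ((h.tensor (refl (𝟙 W))).comp (refl y))).eq_of_closed)

end AgreeOnStates

end Func

/-! ### Random functions with prescribed marginals. -/

/-- A family of probability distributions indexed by a finite type is the family of marginals of a
distribution over functions. -/
theorem SubDist.exists_random_function {α β : Type u} [Finite α] [Finite β] (k : α → SubDist β)
    (hk : ∀ a, (k a).mass = 1) :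
    ∃ d : SubDist (α → β), d.mass = 1 ∧ ∀ a, (d.bind fun f => pure (f a)) = k a := by
  classical
  have := Fintype.ofFinite α
  have := Fintype.ofFinite β
  have hk' (a : α) : ∑ b, (k a).weight b = 1 := by
    rw [← hk a, mass, Finsupp.sum_fintype _ _ (by simp)]
  -- The product distribution: the values at different arguments are drawn independently.
  let w : (α → β) →₀ ℝ≥0 := Finsupp.equivFunOnFinite.symm fun f => ∏ a, (k a).weight (f a)
  have hw (f : α → β) : w f = ∏ a, (k a).weight (f a) := rfl
  have hm : w.sum (fun _ r => r) = 1 := by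
    rw [Finsupp.sum_fintype _ _ (by simp)]
    simp only [hw]
    rw [← Fintype.prod_sum, Finset.prod_congr rfl fun a _ => hk' a, Finset.prod_const_one]
  refine ⟨⟨w, hm.le⟩, hm, fun a => ?_⟩
  ext1
  refine Finsupp.ext fun b => ?_
  change (w.sum fun f r => r • Finsupp.single (f a) 1) b = _
  rw [Finsupp.sum_fintype _ _ (by simp), Finsupp.finsetSum_apply]
  simp only [Finsupp.smul_apply, Finsupp.single_apply, smul_eq_mul, hw]
  -- The indicator of `f a = b` is absorbed into the factor at `a`. The sum over all functions then
  -- factorises, and every factor other than that at `a` is 1.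
  let g (a' : α) (b' : β) : ℝ≥0 :=
    (k a').weight b' * if a' = a then (if b' = b then 1 else 0) else 1
  have hg (f : α → β) : (∏ a', (k a').weight (f a')) * (if f a = b then 1 else 0) =
      ∏ a', g a' (f a') := by
    simp only [g, Finset.prod_mul_distrib]
    congr 1
    rw [Finset.prod_eq_single a (by simp +contextual) (by simp)]
    simp
  simp only [hg]
  rw [← Fintype.prod_sum, Finset.prod_eq_single a]
  · simp [g]
  · intro a' _ h
    simp [g, h, hk']
  · simp

/-! ### Independent composition of random processes -/

namespace SubDist

section

variable {C : Type w} [Category.{u} C]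

/-- The sequential composite of independent random processes. -/
def seq {A B F : C} (d : SubDist (A ⟶ B)) (e : SubDist (B ⟶ F)) : SubDist (A ⟶ F) :=
  d.bind fun f => e.bind fun g => pure (f ≫ g)

variable {A B F G : C}

theorem mass_seq {d : SubDist (A ⟶ B)} {e : SubDist (B ⟶ F)} (hd : d.mass = 1)
    (he : e.mass = 1) : (d.seq e).mass = 1 :=
  (mass_bind _ fun _ => (mass_bind _ fun _ => mass_pure _).trans he).trans hd

theorem pure_seq_pure (f : A ⟶ B) (g : B ⟶ F) : (pure f).seq (pure g) = pure (f ≫ g) := by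
  simp [seq]

theorem id_seq (d : SubDist (A ⟶ B)) : (pure (𝟙 A)).seq d = d := by simp [seq]

theorem seq_id (d : SubDist (A ⟶ B)) : d.seq (pure (𝟙 B)) = d := by simp [seq]

theorem seq_assoc (d : SubDist (A ⟶ B)) (e : SubDist (B ⟶ F)) (f : SubDist (F ⟶ G)) :
    (d.seq e).seq f = d.seq (e.seq f) := by simp [seq]

end

variable {C : Type w} [Category.{u} C] [MonoidalCategory C]

/-- The parallel composite of independent random processes. -/
def par {A B A' B' : C} (d : SubDist (A ⟶ B)) (e : SubDist (A' ⟶ B')) :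
    SubDist (A ⊗ A' ⟶ B ⊗ B') :=
  d.bind fun f => e.bind fun g => pure (f ⊗ₘ g)

variable {A B F A' B' F' : C}

theorem mass_par {d : SubDist (A ⟶ B)} {e : SubDist (A' ⟶ B')} (hd : d.mass = 1)
    (he : e.mass = 1) : (d.par e).mass = 1 :=
  (mass_bind _ fun _ => (mass_bind _ fun _ => mass_pure _).trans he).trans hd

theorem pure_par_pure (f : A ⟶ B) (g : A' ⟶ B') : (pure f).par (pure g) = pure (f ⊗ₘ g) := by
  simp [par]

theorem par_seq_par (d : SubDist (A ⟶ B)) (e : SubDist (B ⟶ F)) (d' : SubDist (A' ⟶ B'))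
    (e' : SubDist (B' ⟶ F')) : (d.par d').seq (e.par e') = (d.seq e).par (d'.seq e') := by
  simp only [seq, par, bind_assoc, pure_bind]
  congr 1
  funext f
  -- The two sides draw from `d'` and `e` in opposite orders.
  rw [bind_comm]
  simp only [MonoidalCategory.tensorHom_comp_tensorHom]

theorem associator_natural (d : SubDist (A ⟶ A')) (e : SubDist (B ⟶ B')) (f : SubDist (F ⟶ F')) :
    ((d.par e).par f).seq (pure (α_ A' B' F').hom) =
      (pure (α_ A B F).hom).seq (d.par (e.par f)) := by
  simp only [seq, par, bind_assoc, pure_bind, MonoidalCategory.associator_naturality]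

theorem leftUnitor_natural (d : SubDist (A ⟶ B)) :
    ((pure (𝟙 (𝟙_ C))).par d).seq (pure (λ_ B).hom) = (pure (λ_ A).hom).seq d := by
  simp [seq, par]

theorem rightUnitor_natural (d : SubDist (A ⟶ B)) :
    (d.par (pure (𝟙 (𝟙_ C)))).seq (pure (ρ_ B).hom) = (pure (ρ_ A).hom).seq d := by
  simp [seq, par]

theorem braiding_natural [SymmetricCategory C] (d : SubDist (A ⟶ A')) (e : SubDist (B ⟶ B')) :
    (d.par e).seq (pure (β_ A' B').hom) = (pure (β_ A B).hom).seq (e.par d) := by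
  simp only [seq, par, bind_assoc, pure_bind, BraidedCategory.braiding_naturality]
  exact bind_comm _ _ _

theorem associator_pentagon (A B F G : C) :
    ((pure (α_ A B F).hom).par (pure (𝟙 G))).seq
        ((pure (α_ A (B ⊗ F) G).hom).seq ((pure (𝟙 A)).par (pure (α_ B F G).hom))) =
      (pure (α_ (A ⊗ B) F G).hom).seq (pure (α_ A B (F ⊗ G)).hom) := by
  simp [pure_seq_pure, pure_par_pure]

theorem unitor_triangle (A B : C) :
    (pure (α_ A (𝟙_ C) B).hom).seq ((pure (𝟙 A)).par (pure (λ_ B).hom)) =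
      (pure (ρ_ A).hom).par (pure (𝟙 B)) := by
  simp [pure_seq_pure, pure_par_pure]

theorem braiding_hexagon [SymmetricCategory C] (A B F : C) :
    (pure (α_ A B F).hom).seq ((pure (β_ A (B ⊗ F)).hom).seq (pure (α_ B F A).hom)) =
      ((pure (β_ A B).hom).par (pure (𝟙 F))).seq
        ((pure (α_ B A F).hom).seq ((pure (𝟙 B)).par (pure (β_ A F).hom))) := by
  simp [pure_seq_pure, pure_par_pure]

theorem braiding_hexagon_inv [SymmetricCategory C] (A B F : C) :
    (pure (α_ A B F).inv).seq ((pure (β_ (A ⊗ B) F).hom).seq (pure (α_ F A B).inv)) =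
      ((pure (𝟙 A)).par (pure (β_ B F).hom)).seq
        ((pure (α_ A F B).inv).seq ((pure (β_ A F).hom).par (pure (𝟙 B)))) := by
  simp [pure_seq_pure, pure_par_pure]

end SubDist

/-! ### Extension of random functions from primitive procedures to all procedures. -/

variable {S : ProcSignature.{u}} {L : OnticStates S}

/-- A choice of a random function for every primitive procedure, extended to all diagrams of
procedures by composing independent random functions. -/
def ProcTerm.random
    (b : ∀ t : S.Procedure, SubDist (L.ont (S.input t) ⟶ L.ont (S.output t))) :
    ∀ {A B}, ProcTerm S A B → SubDist (L.ont A ⟶ L.ont B)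
  | _, _, .box t => b t
  | _, _, .id A => .pure (𝟙 (L.ont A))
  | _, _, .comp f g => (f.random b).seq (g.random b)
  | _, _, .par f g => (f.random b).par (g.random b)
  | _, _, .assoc A B F => .pure (α_ (L.ont A) (L.ont B) (L.ont F)).hom
  | _, _, .assocInv A B F => .pure (α_ (L.ont A) (L.ont B) (L.ont F)).inv
  | _, _, .left A => .pure (λ_ (L.ont A)).hom
  | _, _, .leftInv A => .pure (λ_ (L.ont A)).inv
  | _, _, .right A => .pure (ρ_ (L.ont A)).hom
  | _, _, .rightInv A => .pure (ρ_ (L.ont A)).inv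
  | _, _, .swap A B => .pure (β_ (L.ont A) (L.ont B)).hom

/-- The relations of `Proc` are exactly the laws of a symmetric monoidal category, and independently
composed random functions obey them. No relation constrains the choice of `b`. -/
theorem ProcTerm.Rel.random_eq
    (b : ∀ t : S.Procedure, SubDist (L.ont (S.input t) ⟶ L.ont (S.output t))) {A B}
    {f g : ProcTerm S A B} (h : Rel S f g) : f.random b = g.random b := by
  induction h with
  | comp_left _ _ h => simp only [ProcTerm.random, h]
  | comp_right _ _ h => simp only [ProcTerm.random, h]
  | par_left _ _ h => exact congrArg (SubDist.par · _) h
  | par_right _ _ h => exact congrArg (SubDist.par _) h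
  | id_comp => exact SubDist.id_seq _
  | comp_id => exact SubDist.seq_id _
  | comp_assoc => exact SubDist.seq_assoc _ _ _
  | par_id => exact SubDist.pure_par_pure _ _
  | par_comp => exact SubDist.par_seq_par _ _ _ _
  | assoc_natural => exact SubDist.associator_natural _ _ _
  | left_natural => exact SubDist.leftUnitor_natural _
  | right_natural => exact SubDist.rightUnitor_natural _
  | swap_natural => exact SubDist.braiding_natural _ _
  | pentagon => exact SubDist.associator_pentagon _ _ _ _
  | triangle => exact SubDist.unitor_triangle _ _
  | hexagon => exact SubDist.braiding_hexagon _ _ _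
  | hexagonInv => exact SubDist.braiding_hexagon_inv _ _ _
  | assoc_assocInv => exact (SubDist.pure_seq_pure _ _).trans (congrArg _ (Iso.hom_inv_id _))
  | assocInv_assoc => exact (SubDist.pure_seq_pure _ _).trans (congrArg _ (Iso.inv_hom_id _))
  | left_leftInv => exact (SubDist.pure_seq_pure _ _).trans (congrArg _ (Iso.hom_inv_id _))
  | leftInv_left => exact (SubDist.pure_seq_pure _ _).trans (congrArg _ (Iso.inv_hom_id _))
  | right_rightInv => exact (SubDist.pure_seq_pure _ _).trans (congrArg _ (Iso.hom_inv_id _))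
  | rightInv_right => exact (SubDist.pure_seq_pure _ _).trans (congrArg _ (Iso.inv_hom_id _))
  | swap_swap =>
    exact (SubDist.pure_seq_pure _ _).trans (congrArg _ (SymmetricCategory.symmetry _ _))

theorem ProcTerm.mass_random
    (b : ∀ t : S.Procedure, SubDist (L.ont (S.input t) ⟶ L.ont (S.output t)))
    (hb : ∀ t, (b t).mass = 1) {A B} (f : ProcTerm S A B) : (f.random b).mass = 1 := by
  induction f with
  | box t => exact hb t
  | comp _ _ hf hg => exact SubDist.mass_seq hf hg
  | par _ _ hf hg => exact SubDist.mass_par hf hg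
  | _ => exact SubDist.mass_pure _

/-- The knowledge map that composes independent random functions for the primitive procedures. -/
def KnowledgeMap.ofBoxes
    (b : ∀ t : S.Procedure, SubDist (L.ont (S.input t) ⟶ L.ont (S.output t))) : KnowledgeMap L :=
  fun _ _ => SubStoch.ofFun (Quot.lift (fun f => f.random b) fun _ _ h => h.random_eq b)

namespace KnowledgeMap

variable (b : ∀ t : S.Procedure, SubDist (L.ont (S.input t) ⟶ L.ont (S.output t)))

theorem ofBoxes_isStochastic (hb : ∀ t, (b t).mass = 1) (A B : Proc S) :
    (ofBoxes b A B).IsStochastic := by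
  rintro ⟨f⟩
  exact f.mass_random b hb

theorem ofBoxes_comp {A B F : Proc S} (f : A ⟶ B) (g : B ⟶ F) :
    ofBoxes b A F (f ≫ g) = (ofBoxes b A B f).seq (ofBoxes b B F g) := by
  rcases f with ⟨f⟩
  rcases g with ⟨g⟩
  rfl

theorem ofBoxes_tensor {A B A' B' : Proc S} (f : A ⟶ B) (g : A' ⟶ B') :
    ofBoxes b (A ⊗ A') (B ⊗ B') (f ⊗ₘ g) = (ofBoxes b A B f).par (ofBoxes b A' B' g) := by
  rcases f with ⟨f⟩
  rcases g with ⟨g⟩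
  rfl

theorem ofBoxes_compositional : (ofBoxes b).Compositional where
  seq A B F := by
    funext x
    simp only [SubStoch.comp_apply, SubStoch.tensor_apply, Diag.seqComp, SubStoch.det_apply,
      SubDist.pure_bind, SubDist.bind_assoc]
    exact (ofBoxes_comp b x.1 x.2).symm
  par A B A' B' := by
    funext x
    simp only [SubStoch.comp_apply, SubStoch.tensor_apply, Diag.parComp, SubStoch.det_apply,
      SubDist.pure_bind, SubDist.bind_assoc]
    exact (ofBoxes_tensor b x.1 x.2).symm
  id A := funext fun _ => SubDist.pure_bind _ _
  associator A B F := funext fun _ => SubDist.pure_bind _ _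
  leftUnitor A := funext fun _ => SubDist.pure_bind _ _
  rightUnitor A := funext fun _ => SubDist.pure_bind _ _
  braiding A B := funext fun _ => SubDist.pure_bind _ _

end KnowledgeMap

/-! ### Processes with independent random knowledge. -/

namespace CI

variable {C : Type w} [Category.{u} C] [MonoidalCategory.{u} C] [SymmetricCategory.{u} C]
variable {K : Readout.{u} C} {R : ∀ P Q : CISys.{u} C, Diag K P Q → Diag K P Q → Prop}
variable {A B F A' B' F' A'' B'' : C} {X Y Z X' Y' Z' X'' Y'' : Type u}

theorem unit_par (D : sys R A X ⟶ sys R B Y) :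
    par (𝟙 (sys R (𝟙_ C) PUnit)) D ≫ embed R (λ_ B).hom (SubStoch.det Prod.snd) =
      embed R (λ_ A).hom (SubStoch.det Prod.snd) ≫ D := by
  rcases D with ⟨D⟩
  exact Quot.sound (.left_natural D)

theorem par_swap (D : sys R A X ⟶ sys R A' X') (E : sys R B Y ⟶ sys R B' Y') :
    par D E ≫ embed R (β_ A' B').hom (SubStoch.det Prod.swap) =
      embed R (β_ A B).hom (SubStoch.det Prod.swap) ≫ par E D := by
  rcases D with ⟨D⟩
  rcases E with ⟨E⟩
  exact Quot.sound (.swap_natural D E)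

theorem know_ignore (A B : C) :
    know K R A B ≫ ignore K R B = embed R (𝟙 A) (SubStoch.discard _) ≫ ignore K R A :=
  Quot.sound (.know_ignore A B)

/-- The rule `know_ignore` at certain knowledge. Transported along `ξ`, it is the hypothesis under
which a process agrees with a random function. -/
theorem embed_ignore (t : A ⟶ B) :
    embed R t (SubStoch.id PUnit) ≫ ignore K R B = ignore K R A := by
  rw [embed_know, Category.assoc, know_ignore, embed_comp_assoc, Category.comp_id]
  have e : (SubStoch.point t).comp (SubStoch.discard _) = SubStoch.id PUnit := by
    funext x; simp
  rw [e, embed_id, Category.id_comp]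

/-- A process with independent random knowledge `d` of it, next to an inferential process. -/
def embedRandom (d : SubDist (A ⟶ B)) (s : SubStoch X Y) : sys R A X ⟶ sys R B Y :=
  feed (SubStoch.ofFun fun x => d.bind fun f => (s x).bind fun y => SubDist.pure (f, y))

theorem embedRandom_pure (t : A ⟶ B) (s : SubStoch X Y) :
    embedRandom (SubDist.pure t) s = embed (K := K) R t s := by
  rw [embedRandom, embed_eq_feed]
  simp

/-- As the random process is independent of the inferential one, the second draw of a process
commutes with `s`. -/
theorem embedRandom_comp (d : SubDist (A ⟶ B)) (e : SubDist (B ⟶ F)) (s : SubStoch X Y)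
    (t : SubStoch Y Z) :
    embedRandom d s ≫ embedRandom e t = embedRandom (K := K) (R := R) (d.seq e) (s.comp t) := by
  rw [embedRandom, embedRandom, embedRandom, feed_comp]
  congr 1
  funext x
  simp only [SubStoch.ofFun_apply, SubDist.seq, SubStoch.comp_apply, SubDist.bind_assoc,
    SubDist.pure_bind]
  congr 1
  funext f
  rw [SubDist.bind_comm]

theorem embedRandom_par (d : SubDist (A ⟶ B)) (e : SubDist (A' ⟶ B')) (s : SubStoch X Y)
    (t : SubStoch X' Y') :
    par (embedRandom d s) (embedRandom e t) =
      embedRandom (K := K) (R := R) (d.par e) (s.tensor t) := by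
  rw [embedRandom, embedRandom, embedRandom, feed_par]
  congr 1
  funext x
  simp only [SubStoch.ofFun_apply, SubDist.par, SubStoch.tensor_apply, SubDist.bind_assoc,
    SubDist.pure_bind]
  congr 1
  funext f
  rw [SubDist.bind_comm]

theorem embed_comp_feed (s : SubStoch X Y) (r : SubStoch Y ((A ⟶ B) × Z)) :
    embed R (𝟙 A) s ≫ feed (K := K) r = feed (s.comp r) := by
  rw [feed, feed, embed_comp_assoc, Category.comp_id]

/-- Every process factors through one without inferential input and output. -/
theorem embed_eq_split (t : A ⟶ B) (s : SubStoch X Y) :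
    embed R t s = (split (K := K) R A X).hom ≫
      (embed R t (SubStoch.id PUnit) ⊗ₘ embed R (𝟙 (𝟙_ C)) s) ≫ (split R B Y).inv := by
  change _ = embed R (ρ_ A).inv (SubStoch.det (Equiv.punitProd X).symm) ≫
    par (embed R t (SubStoch.id PUnit)) (embed R (𝟙 (𝟙_ C)) s) ≫
      embed R (ρ_ B).hom (SubStoch.det (Equiv.punitProd Y))
  rw [embed_par, embed_comp, embed_comp]
  congr 1
  · simp
  · funext x
    simp

/-- Copying the trivial inferential system. -/
theorem embed_par_punit (t : A ⟶ B) (t' : A' ⟶ B') :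
    embed (K := K) R (t ⊗ₘ t') (SubStoch.id PUnit.{u + 1}) =
      embed R (𝟙 _) (SubStoch.copy _) ≫
        par (embed R t (SubStoch.id PUnit)) (embed R t' (SubStoch.id PUnit)) ≫
          embed R (𝟙 _) (SubStoch.discard _) := by
  rw [embed_par, embed_comp, embed_comp, Category.comp_id, Category.id_comp]
  congr 1
  funext x
  simp [SubStoch.copy]

theorem par_embedRandom_punit (d : SubDist (A ⟶ B)) (e : SubDist (A' ⟶ B')) :
    embedRandom (K := K) (R := R) (d.par e) (SubStoch.id PUnit.{u + 1}) =
      embed R (𝟙 _) (SubStoch.copy _) ≫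
        par (embedRandom d (SubStoch.id PUnit)) (embedRandom e (SubStoch.id PUnit)) ≫
          embed R (𝟙 _) (SubStoch.discard _) := by
  rw [embedRandom_par, ← embedRandom_pure, ← embedRandom_pure, embedRandom_comp, embedRandom_comp,
    SubDist.id_seq, SubDist.seq_id]
  congr 1
  funext x
  simp [SubStoch.copy]

/-- The counterpart of `embed_eq_split`; it reduces agreement of a procedure next to an inferential
process to agreement of the procedure alone. -/
theorem embedRandom_eq_split (d : SubDist (A ⟶ B)) (s : SubStoch X Y) :
    embedRandom d s = embed (K := K) R (ρ_ A).inv (SubStoch.det (Equiv.punitProd X).symm) ≫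
      par (embedRandom d (SubStoch.id PUnit)) (embed R (𝟙 _) s) ≫
        embed R (ρ_ B).hom (SubStoch.det (Equiv.punitProd Y)) := by
  rw [← embedRandom_pure, ← embedRandom_pure, ← embedRandom_pure, embedRandom_par,
    embedRandom_comp, embedRandom_comp, SubDist.rightUnitor_natural, ← SubDist.seq_assoc,
    SubDist.pure_seq_pure, Iso.inv_hom_id, SubDist.id_seq]
  congr 1
  funext x
  simp

theorem know_eq_feed_ofFun {Ξ : SubStoch X (A ⟶ B)} :
    embed R (𝟙 A) Ξ ≫ know K R A B =
      feed (SubStoch.ofFun fun x => (Ξ x).bind fun f => SubDist.pure (f, PUnit.unit)) := by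
  rw [know_eq_feed, embed_comp_feed]
  rfl

end CI

/-! ### Faithfulness of inference, and ignorability as normalisation. -/

namespace Func
open CI
variable {A B A' B' : Func.{u}} {X Y X' Y' : Type u}

theorem exists_prepare_comp (D : sys Rules A X ⟶ sys Rules B Y) :
    ∃ s : SubStoch (A.carrier × X) (B.carrier × Y),
      prepare A X ≫ D = embed Rules (𝟙 _) s ≫ prepare B Y :=
  exists_prepareSys_comp D

theorem prepare_ignore (A : Func.{u}) :
    prepare A PUnit ≫ ignore readout Rules A = embed Rules (𝟙 _) (SubStoch.discard _) := by
  rw [ignore_eq_embed, prepare_embed, prepare_unit, embed_comp, Category.comp_id]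
  congr 1
  funext x
  simp

/-- The existence of a left inverse `q` to the inclusion shows that rewriting identifies no two
distinct substochastic maps. -/
theorem embed_injective (q : RealistPredictions.{u}) {s t : SubStoch X Y}
    (h : embed Rules (𝟙 (𝟙_ Func.{u})) s = embed Rules (𝟙 (𝟙_ Func.{u})) t) : s = t := by
  have h' := congrArg q.map h
  rwa [show q.map (embed Rules (𝟙 (𝟙_ Func.{u})) s) = s from q.map_infer s,
    show q.map (embed Rules (𝟙 (𝟙_ Func.{u})) t) = t from q.map_infer t] at h'

/-- Processes without causal input and output are inferential. -/
theorem eq_embed_map (q : RealistPredictions.{u})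
    (D : sys Rules (𝟙_ Func.{u}) X ⟶ sys Rules (𝟙_ Func.{u}) Y) :
    D = embed Rules (𝟙 _) (q.map D) := by
  obtain ⟨s, hs⟩ := exists_prepare_comp D
  have e : embed Rules (𝟙 (𝟙_ Func.{u}))
      (SubStoch.det (Y := (𝟙_ Func.{u}).carrier × X) fun x : X => (PUnit.unit, x)) ≫
        prepare (𝟙_ Func.{u}) X = 𝟙 _ := by
    rw [prepare_unit, embed_comp, SubStoch.det_comp_det, Category.id_comp]
    exact embed_det_id _ _
  -- Preparing the trivial system is itself inferential, so the normal form of `D` is inferential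
  -- once the preparation is cancelled. The prediction map then identifies `t`.
  have h : ∃ t, D = embed Rules (𝟙 _) t := by
    refine ⟨((SubStoch.det fun x : X => (PUnit.unit, x)).comp s).comp (SubStoch.det Prod.snd), ?_⟩
    rw [← Category.id_comp D, ← e, Category.assoc, hs, prepare_unit, embed_comp_assoc, embed_comp,
      Category.comp_id, Category.comp_id]
    rfl
  obtain ⟨t, rfl⟩ := h
  exact congrArg _ (q.map_infer t).symm

/-- Observing a prepared state and mapping the system to the singleton recovers the knowledge that
was prepared. -/
theorem embed_prepare_injective (q : RealistPredictions.{u})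
    {s t : SubStoch X (A.carrier × PUnit.{u + 1})}
    (h : embed Rules (𝟙 _) s ≫ prepare A PUnit = embed Rules (𝟙 _) t ≫ prepare A PUnit) :
    s = t := by
  have e : prepare A PUnit ≫ observe A ≫
        embed Rules (ofFun fun _ => PUnit.unit : A ⟶ 𝟙_ Func.{u}) (SubStoch.id _) =
      embed Rules (𝟙 _) (SubStoch.det Prod.fst) := by
    rw [reassoc_of% prepare_observe A, prepare_embed, prepare_unit, embed_comp, embed_comp,
      Category.comp_id, Category.comp_id]
    congr 1
    funext x
    simp
  have h' := congrArg (fun G => G ≫ observe A ≫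
    embed Rules (ofFun fun _ => PUnit.unit : A ⟶ 𝟙_ Func.{u}) (SubStoch.id _)) h
  simp only [Category.assoc, e, embed_comp, Category.comp_id] at h'
  have h'' := congrArg (fun r => r.comp (SubStoch.det fun a => (a, PUnit.unit)))
    (embed_injective q h')
  have e' (s : SubStoch X (A.carrier × PUnit.{u + 1})) :
      (s.comp (SubStoch.det Prod.fst)).comp (SubStoch.det fun a => (a, PUnit.unit)) = s := by
    funext x
    simp only [SubStoch.comp_apply, SubStoch.det_apply, SubDist.bind_assoc, SubDist.pure_bind]
    exact SubDist.bind_pure _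
  simpa only [e'] using h''

theorem prepare_embedRandom (d : SubDist (A ⟶ B)) (s : SubStoch X Y) :
    prepare A X ≫ embedRandom d s = embed Rules (𝟙 _)
      (SubStoch.ofFun fun x => d.bind fun f => (s x.2).bind fun y =>
        SubDist.pure (Hom.toFun f x.1, y)) ≫ prepare B Y := by
  rw [embedRandom, prepare_feed]
  congr 2
  funext x
  simp

/-- A process that preserves ignorability agrees with a random function. -/
theorem exists_embedRandom (q : RealistPredictions.{u})
    (D : sys Rules A PUnit ⟶ sys Rules B PUnit)
    (hD : D ≫ ignore readout Rules B = ignore readout Rules A) :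
    ∃ d : SubDist (A ⟶ B), d.mass = 1 ∧
      AgreeOnStates D (embedRandom d (SubStoch.id PUnit)) := by
  obtain ⟨s, hs⟩ := exists_prepare_comp D
  -- On prepared states, ignoring is discarding, so preservation of ignorability says that `s` is
  -- normalised.
  have h₁ : s.comp (SubStoch.discard _) = SubStoch.discard _ := by
    refine embed_injective q ?_
    rw [← Category.comp_id (𝟙 (𝟙_ Func.{u})), ← embed_comp, ← prepare_ignore, ← reassoc_of% hs, hD,
      prepare_ignore, Category.comp_id]
  have h₂ (x) : (s x).mass = 1 := by
    have h := congrArg SubDist.mass (congrFun h₁ x)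
    exact (SubDist.mass_bind (s x) fun _ => SubDist.mass_pure PUnit.unit).symm.trans
      (h.trans (SubDist.mass_pure _))
  have := A.finite
  have := B.finite
  -- The distribution of the output state given the input state `a`, realised as the law of `f a`
  -- for a random `f`.
  obtain ⟨d, hd, hk⟩ := SubDist.exists_random_function
    (fun a => (s (a, PUnit.unit)).bind fun y => SubDist.pure y.1)
    (fun a => (SubDist.mass_bind _ fun _ => SubDist.mass_pure _).trans (h₂ _))
  refine ⟨d, hd, ?_⟩
  change prepare A PUnit ≫ D = prepare A PUnit ≫ _
  rw [hs, prepare_embedRandom]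
  congr 2
  funext x
  have h := congrArg (fun e => e.bind fun b => SubDist.pure (b, PUnit.unit.{u + 1})) (hk x.1)
  simp only [SubDist.bind_assoc, SubDist.pure_bind] at h
  simp
  exact (h.trans (SubDist.bind_pure _)).symm

end Func

variable {S : ProcSignature.{u}} {L : OnticStates S} {p : OperationalPredictions S}
  {q : RealistPredictions.{u}}

/-! ### Action of a representation on inference, wiring and procedures. -/

namespace ClassicalRealistRepresentation
open CI Func

variable (ξ : ClassicalRealistRepresentation p q L) {A B A' B' F : Proc S} {X Y X' Y' : Type u}

/-- The image of a process, with the components of the systems made explicit. -/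
def onSys (D : sys (Proc.rules S) A X ⟶ sys (Proc.rules S) B Y) :
    sys Rules.{u} (L.ont A) X ⟶ sys Rules.{u} (L.ont B) Y := ξ.map D

theorem onSys_id : ξ.onSys (𝟙 (sys (Proc.rules S) A X)) = 𝟙 (sys Rules (L.ont A) X) :=
  ξ.map_id _

theorem onSys_comp {Z : Type u} (D : sys (Proc.rules S) A X ⟶ sys (Proc.rules S) B Y)
    (E : sys (Proc.rules S) B Y ⟶ sys (Proc.rules S) F Z) :
    ξ.onSys (D ≫ E) = ξ.onSys D ≫ ξ.onSys E := ξ.map_comp _ _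

theorem onSys_par (D : sys (Proc.rules S) A X ⟶ sys (Proc.rules S) B Y)
    (E : sys (Proc.rules S) A' X' ⟶ sys (Proc.rules S) B' Y') :
    (ξ.onSys (par D E) :
      sys Rules (L.ont A ⊗ L.ont A') (X × X') ⟶ sys Rules (L.ont B ⊗ L.ont B') (Y × Y')) =
      par (ξ.onSys D) (ξ.onSys E) := ξ.map_tensor _ _

theorem onSys_split (A : Proc S) (X : Type u) :
    ξ.onSys (embed (Proc.rules S) (ρ_ A).inv (SubStoch.det (Equiv.punitProd X).symm)) =
      embed Rules (ρ_ (L.ont A)).inv (SubStoch.det (Equiv.punitProd X).symm) :=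
  ξ.map_split A X

/-- That `ξ` fixes inferential processes is a consequence of preserving predictions: a closed
realist process is the embedding of its own prediction. -/
theorem onSys_infer_unit (s : SubStoch X Y) :
    ξ.onSys (embed (Proc.rules S) (𝟙 (𝟙_ (Proc S))) s) = embed Rules (𝟙 (𝟙_ Func.{u})) s := by
  refine (eq_embed_map q _).trans (congrArg _ ?_)
  exact (ξ.map_predictions (infer s)).trans (p.map_infer s)

theorem onSys_unsplit (A : Proc S) (X : Type u) :
    ξ.onSys (embed (Proc.rules S) (ρ_ A).hom (SubStoch.det (Equiv.punitProd X))) =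
      embed Rules (ρ_ (L.ont A)).hom (SubStoch.det (Equiv.punitProd X)) := by
  have h₁ := congrArg ξ.onSys (split (Proc.rules S) A X).inv_hom_id
  have h₂ := (split Rules (L.ont A) X).hom_inv_id
  change ξ.onSys (embed (Proc.rules S) (ρ_ A).hom (SubStoch.det (Equiv.punitProd X)) ≫
    embed (Proc.rules S) (ρ_ A).inv (SubStoch.det (Equiv.punitProd X).symm)) =
      ξ.onSys (𝟙 (sys (Proc.rules S) (A ⊗ 𝟙_ (Proc S)) (PUnit × X))) at h₁
  change embed Rules (ρ_ (L.ont A)).inv (SubStoch.det (Equiv.punitProd X).symm) ≫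
    embed Rules (ρ_ (L.ont A)).hom (SubStoch.det (Equiv.punitProd X)) = 𝟙 _ at h₂
  rw [onSys_comp, onSys_id, onSys_split] at h₁
  refine (Category.comp_id _).symm.trans ((congrArg _ h₂.symm).trans ?_)
  refine (Category.assoc _ _ _).symm.trans ?_
  refine (congrArg (· ≫ embed Rules (ρ_ (L.ont A)).hom (SubStoch.det (Equiv.punitProd X)))
    h₁).trans ?_
  exact Category.id_comp _

theorem onSys_embed (t : A ⟶ B) (s : SubStoch X Y) :
    ξ.onSys (embed (Proc.rules S) t s) =
      embed Rules (ρ_ (L.ont A)).inv (SubStoch.det (Equiv.punitProd X).symm) ≫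
        par (ξ.onSys (embed (Proc.rules S) t (SubStoch.id PUnit))) (embed Rules (𝟙 _) s) ≫
          embed Rules (ρ_ (L.ont B)).hom (SubStoch.det (Equiv.punitProd Y)) := by
  rw [embed_eq_split]
  change ξ.onSys (embed (Proc.rules S) (ρ_ A).inv (SubStoch.det (Equiv.punitProd X).symm) ≫
    par (embed (Proc.rules S) t (SubStoch.id PUnit)) (embed (Proc.rules S) (𝟙 _) s) ≫
      embed (Proc.rules S) (ρ_ B).hom (SubStoch.det (Equiv.punitProd Y))) = _
  rw [onSys_comp, onSys_comp, onSys_split, onSys_unsplit]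
  exact congrArg (fun E => _ ≫ E ≫ _) ((ξ.onSys_par _ _).trans
    (congrArg (par _) (ξ.onSys_infer_unit s)))

theorem onSys_embed_of_punit {t : A ⟶ B} {t' : L.ont A ⟶ L.ont B}
    (h : ξ.onSys (embed (Proc.rules S) t (SubStoch.id PUnit)) =
      embed Rules t' (SubStoch.id PUnit)) (s : SubStoch X Y) :
    ξ.onSys (embed (Proc.rules S) t s) = embed Rules t' s := by
  rw [onSys_embed, h]
  exact (embed_eq_split t' s).symm

theorem onSys_infer (A : Proc S) (s : SubStoch X Y) :
    ξ.onSys (embed (Proc.rules S) (𝟙 A) s) = embed Rules (𝟙 (L.ont A)) s := by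
  refine ξ.onSys_embed_of_punit ?_ s
  rw [embed_id, embed_id]
  exact ξ.onSys_id

/-- The axioms on wiring fix a particular inferential part `f`. Supplying a point `x` and discarding
the result strips it off, after which any other part `s` can be attached. -/
theorem onSys_embed_of_det {t : A ⟶ B} {t' : L.ont A ⟶ L.ont B} (f : X → Y) (x : X)
    (h : ξ.onSys (embed (Proc.rules S) t (SubStoch.det f)) = embed Rules t' (SubStoch.det f))
    (s : SubStoch X' Y') :
    ξ.onSys (embed (Proc.rules S) t s) = embed Rules t' s := by
  refine ξ.onSys_embed_of_punit ?_ s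
  have e : ((SubStoch.det fun _ => x).comp (SubStoch.det f)).comp (SubStoch.discard _) =
      SubStoch.id PUnit.{u + 1} := by
    funext x
    simp
  have h₁ : embed (Proc.rules S) t (SubStoch.id PUnit) = embed (Proc.rules S) (𝟙 A)
      (SubStoch.det fun _ => x) ≫ embed (Proc.rules S) t (SubStoch.det f) ≫
        embed (Proc.rules S) (𝟙 B) (SubStoch.discard _) := by
    rw [embed_comp_assoc, embed_comp, Category.id_comp, Category.comp_id, e]
  rw [h₁, onSys_comp, onSys_comp, onSys_infer, onSys_infer, h, embed_comp_assoc, embed_comp,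
    Category.id_comp, Category.comp_id, e]

theorem onSys_embed_inv {t : A ≅ B} {t' : L.ont A ≅ L.ont B}
    (h : ξ.onSys (embed (Proc.rules S) t.hom (SubStoch.id PUnit)) =
      embed Rules t'.hom (SubStoch.id PUnit)) (s : SubStoch X Y) :
    ξ.onSys (embed (Proc.rules S) t.inv s) = embed Rules t'.inv s := by
  refine ξ.onSys_embed_of_punit ?_ s
  have h₁ : ξ.onSys (embed (Proc.rules S) t.inv (SubStoch.id PUnit)) ≫
      embed Rules t'.hom (SubStoch.id PUnit) = 𝟙 _ := by
    rw [← h, ← onSys_comp, embed_comp, Iso.inv_hom_id, SubStoch.id_comp, embed_id]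
    exact ξ.onSys_id
  have h₂ : embed Rules t'.hom (SubStoch.id PUnit) ≫ embed Rules t'.inv (SubStoch.id PUnit) =
      𝟙 _ := by
    rw [embed_comp, Iso.hom_inv_id, SubStoch.id_comp, embed_id]
  rw [← Category.comp_id (ξ.onSys _), ← h₂, ← Category.assoc, h₁, Category.id_comp]

theorem onSys_associator (A B F : Proc S) (s : SubStoch X Y) :
    ξ.onSys (embed (Proc.rules S) (α_ A B F).hom s) =
      embed Rules (α_ (L.ont A) (L.ont B) (L.ont F)).hom s :=
  ξ.onSys_embed_of_det (Equiv.prodAssoc PUnit PUnit PUnit) default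
    (ξ.map_associator (sys _ A PUnit) (sys _ B PUnit) (sys _ F PUnit)) s

theorem onSys_leftUnitor (A : Proc S) (s : SubStoch X Y) :
    ξ.onSys (embed (Proc.rules S) (λ_ A).hom s) = embed Rules (λ_ (L.ont A)).hom s :=
  ξ.onSys_embed_of_det (Equiv.punitProd PUnit) default (ξ.map_leftUnitor (sys _ A PUnit)) s

theorem onSys_rightUnitor (A : Proc S) (s : SubStoch X Y) :
    ξ.onSys (embed (Proc.rules S) (ρ_ A).hom s) = embed Rules (ρ_ (L.ont A)).hom s :=
  ξ.onSys_embed_of_det (Equiv.prodPUnit PUnit) default (ξ.map_rightUnitor (sys _ A PUnit)) s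

theorem onSys_braiding (A B : Proc S) (s : SubStoch X Y) :
    ξ.onSys (embed (Proc.rules S) (β_ A B).hom s) =
      embed Rules (β_ (L.ont A) (L.ont B)).hom s :=
  ξ.onSys_embed_of_det (Equiv.prodComm PUnit PUnit) default
    (ξ.map_braiding (sys _ A PUnit) (sys _ B PUnit)) s

theorem onSys_associator_inv (A B F : Proc S) (s : SubStoch X Y) :
    ξ.onSys (embed (Proc.rules S) (α_ A B F).inv s) =
      embed Rules (α_ (L.ont A) (L.ont B) (L.ont F)).inv s :=
  ξ.onSys_embed_inv (t := α_ A B F) (t' := α_ (L.ont A) (L.ont B) (L.ont F))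
    (ξ.onSys_associator A B F _) s

theorem onSys_leftUnitor_inv (A : Proc S) (s : SubStoch X Y) :
    ξ.onSys (embed (Proc.rules S) (λ_ A).inv s) = embed Rules (λ_ (L.ont A)).inv s :=
  ξ.onSys_embed_inv (t := λ_ A) (t' := λ_ (L.ont A)) (ξ.onSys_leftUnitor A _) s

theorem onSys_rightUnitor_inv (A : Proc S) (s : SubStoch X Y) :
    ξ.onSys (embed (Proc.rules S) (ρ_ A).inv s) = embed Rules (ρ_ (L.ont A)).inv s :=
  ξ.onSys_embed_inv (t := ρ_ A) (t' := ρ_ (L.ont A)) (ξ.onSys_rightUnitor A _) s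

theorem onSys_ignore (A : Proc S) :
    ξ.onSys (ignore (Proc.readout S) (Proc.rules S) A) = ignore readout Rules (L.ont A) :=
  ξ.map_ignore A

/-- Every procedure is represented by a process that agrees with a random function. -/
theorem exists_embedRandom (t : A ⟶ B) :
    ∃ d : SubDist (L.ont A ⟶ L.ont B), d.mass = 1 ∧
      AgreeOnStates (ξ.onSys (embed (Proc.rules S) t (SubStoch.id PUnit)))
        (embedRandom d (SubStoch.id PUnit)) := by
  refine Func.exists_embedRandom q _ ?_
  have h := congrArg ξ.onSys (embed_ignore (K := Proc.readout S) (R := Proc.rules S) t)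
  rw [onSys_comp, onSys_ignore] at h
  exact h.trans (ξ.onSys_ignore A)

/-- Induction on the procedure: `ξ` preserves composition and wiring, and `AgreeOnStates` is a
congruence, so agreement on the boxes suffices. -/
theorem agree_random {b : ∀ t : S.Procedure, SubDist (L.ont (S.input t) ⟶ L.ont (S.output t))}
    (hb : ∀ t, AgreeOnStates
      (ξ.onSys (embed (Proc.rules S) (A := S.input t) (B := S.output t) (Quot.mk _ (.box t))
        (SubStoch.id PUnit)))
      (embedRandom (b t) (SubStoch.id PUnit)))
    {A B : Proc S} (t : ProcTerm S A B) :
    AgreeOnStates (ξ.onSys (embed (Proc.rules S) (A := A) (B := B) (Quot.mk _ t)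
      (SubStoch.id PUnit))) (embedRandom (t.random b) (SubStoch.id PUnit)) := by
  have hw {A B : Proc S} {t : A ⟶ B} {t' : L.ont A ⟶ L.ont B}
      (h : ξ.onSys (embed (Proc.rules S) t (SubStoch.id PUnit)) =
        embed Rules t' (SubStoch.id PUnit)) :
      AgreeOnStates (ξ.onSys (embed (Proc.rules S) t (SubStoch.id PUnit)))
        (embedRandom (SubDist.pure t') (SubStoch.id PUnit)) := by
    rw [h, embedRandom_pure]
    exact .refl _
  induction t with
  | box t => exact hb t
  | id A => exact hw (ξ.onSys_infer A _)
  | @comp A B F f g hf hg => 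
    have h := hf.comp hg
    rw [embedRandom_comp, SubStoch.id_comp] at h
    refine Eq.trans ?_ h
    refine congrArg _ ?_
    refine Eq.trans (congrArg ξ.onSys ?_) (ξ.onSys_comp _ _)
    exact ((embed_comp (R := Proc.rules S) (A := A) (B := B) (F := F) (Quot.mk _ f)
      (Quot.mk _ g) _ _).trans (congrArg _ (SubStoch.id_comp _))).symm
  | @par A B A' B' f g hf hg =>
    -- A parallel composite has inferential part `PUnit × PUnit`; copying before it and discarding
    -- after it reduces this to `PUnit`.
    have h := (AgreeOnStates.refl (embed Rules (𝟙 (L.ont A ⊗ L.ont A'))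
      (SubStoch.copy PUnit))).comp ((hf.par hg).comp (AgreeOnStates.refl
        (embed Rules (𝟙 (L.ont B ⊗ L.ont B')) (SubStoch.discard _))))
    rw [← par_embedRandom_punit] at h
    refine Eq.trans (congrArg _ ?_) h
    refine (congrArg ξ.onSys (embed_par_punit (R := Proc.rules S) (A := A) (B := B) (A' := A')
      (B' := B') (Quot.mk _ f) (Quot.mk _ g))).trans ?_
    refine (ξ.onSys_comp _ _).trans (congrArg₂ _ (ξ.onSys_infer _ _) ?_)
    exact (ξ.onSys_comp _ _).trans (congrArg₂ _ (ξ.onSys_par _ _) (ξ.onSys_infer _ _))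
  | assoc A B F => exact hw (ξ.onSys_associator A B F _)
  | assocInv A B F => exact hw (ξ.onSys_associator_inv A B F _)
  | left A => exact hw (ξ.onSys_leftUnitor A _)
  | leftInv A => exact hw (ξ.onSys_leftUnitor_inv A _)
  | right A => exact hw (ξ.onSys_rightUnitor A _)
  | rightInv A => exact hw (ξ.onSys_rightUnitor_inv A _)
  | swap A B => exact hw (ξ.onSys_braiding A B _)

end ClassicalRealistRepresentation

variable {S : ProcSignature.{u}} {L : OnticStates S} {p : OperationalPredictions S}
  {q : RealistPredictions.{u}}

/-! ### The rules for knowledge in the natural form. -/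

namespace KnowledgeMap
open CI Func

variable {Ξ : KnowledgeMap L}

/-- The map `Ξ B F` slides in front of the first `know`, the rule `know_seq` of the realist theory
merges the generators, and compositionality moves `Ξ` behind the composition of procedures. -/
theorem Compositional.natural_seq (hΞ : Ξ.Compositional) (A B F : Proc S) :
    beside (Ξ.natural A B) (B ⟶ F) ≫ embed Rules (𝟙 (L.ont B)) (SubStoch.det Prod.snd) ≫
        Ξ.natural B F =
      embed Rules (𝟙 (L.ont A)) (Diag.seqComp A B F) ≫ Ξ.natural A F := by
  have e : (SubStoch.det Prod.snd : SubStoch (PUnit.{u + 1} × (B ⟶ F)) _).comp (Ξ B F) =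
      ((SubStoch.id _).tensor (Ξ B F)).comp (SubStoch.det Prod.snd) := by
    funext x
    simp only [SubStoch.comp_apply, SubStoch.tensor_apply, SubStoch.det_apply, SubStoch.id_apply,
      SubDist.bind_assoc, SubDist.pure_bind]
    exact (SubDist.bind_pure _).symm
  have e' : ((Ξ A B).tensor (SubStoch.id (B ⟶ F))).comp ((SubStoch.id _).tensor (Ξ B F)) =
      (Ξ A B).tensor (Ξ B F) := by
    funext x
    simp only [SubStoch.comp_apply, SubStoch.tensor_apply, SubStoch.id_apply,
      SubDist.bind_assoc, SubDist.pure_bind]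
  rw [natural, natural, natural, beside_comp, beside_embed, embed_comp_assoc, e,
    ← embed_comp, Category.assoc, Category.assoc, reassoc_of% (beside_slide (know _ _ _ _) (Ξ B F)),
    know_seq, embed_comp_assoc, embed_comp_assoc, embed_comp_assoc, ← hΞ.seq, e',
    Category.comp_id]

theorem Compositional.natural_par (hΞ : Ξ.Compositional) (A B A' B' : Proc S) :
    CI.par (Ξ.natural A B) (Ξ.natural A' B') ≫
        embed Rules (𝟙 (L.ont B ⊗ L.ont B')) (SubStoch.discard _) =
      embed Rules (𝟙 (L.ont (A ⊗ A' : Proc S))) (Diag.parComp A B A' B') ≫ Ξ.natural (A ⊗ A') (B ⊗ B') := by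
  rw [natural, natural, natural, ← par_comp, embed_par, Category.assoc, know_par,
    embed_comp_assoc, embed_comp_assoc, ← hΞ.par, MonoidalCategory.id_tensorHom_id]
  rfl

/-- Stochasticity is what is needed here: discarding after `Ξ A B` must be discarding. -/
theorem natural_ignore (h : ∀ A B : Proc S, (Ξ A B).IsStochastic) (A B : Proc S) :
    Ξ.natural A B ≫ ignore readout Rules (L.ont B) =
      embed Rules (𝟙 (L.ont A)) (SubStoch.discard _) ≫ ignore readout Rules (L.ont A) := by
  have e : (Ξ A B).comp (SubStoch.discard _) = SubStoch.discard _ := by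
    funext f
    exact SubDist.bind_const _ (h A B f) _
  rw [natural, Category.assoc, know_ignore, embed_comp_assoc, e, Category.comp_id]

theorem point_natural (Ξ : KnowledgeMap L) {A B : Proc S} (f : A ⟶ B) :
    embed Rules (𝟙 (L.ont A)) (SubStoch.point f) ≫ Ξ.natural A B =
      embedRandom (Ξ A B f) (SubStoch.id PUnit) := by
  rw [natural, embed_comp_assoc, Category.comp_id, know_eq_feed_ofFun, embedRandom]
  congr 1
  funext x
  simp

end KnowledgeMap

/-! ### The representation of natural form and its agreement with the given one. -/

namespace ClassicalRealistRepresentation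
open CI Func KnowledgeMap

variable (ξ : ClassicalRealistRepresentation p q L)
  (b : ∀ t : S.Procedure, SubDist (L.ont (S.input t) ⟶ L.ont (S.output t)))

/-- The natural interpretation of diagrams of the operational theory: knowledge of procedures is
mapped to knowledge of functions, and learning is interpreted as in `ξ`. -/
def interpret : ∀ {P Q : CISys.{u} (Proc S)}, Diag (Proc.readout S) P Q →
    (sys Rules.{u} (L.ont P.caus) P.inf ⟶ sys Rules.{u} (L.ont Q.caus) Q.inf)
  | _, _, .id _ => 𝟙 _
  | _, _, .comp D E => interpret D ≫ interpret E
  | _, _, .par D E => par (interpret D) (interpret E)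
  | _, _, .embed t s => embedRandom (ofBoxes b _ _ t) s
  | _, _, .know A B => (ofBoxes b).natural A B
  | _, _, .learn A h => ξ.onSys (learn (Proc.readout S) (Proc.rules S) A h)
  | _, _, .ignore A => ignore readout Rules (L.ont A)

variable {A B A' B' F : Proc S} {X Y X' Y' : Type u}

theorem interpret_infer (A : Proc S) (s : SubStoch X Y) :
    ξ.interpret b (Diag.infer A s) = embed Rules (𝟙 (L.ont A)) s := embedRandom_pure _ _

theorem interpret_beside (D : Diag (Proc.readout S) ⟨A, X⟩ ⟨B, Y⟩) (Z : Type u) :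
    ξ.interpret b (D.beside Z) = beside (ξ.interpret b D) Z :=
  congrArg₂ _ (embedRandom_pure _ _) (congrArg₂ _ rfl (embedRandom_pure _ _))

/-- The natural interpretation of a diagram coincides with that by `ξ`. -/
def Coincides {P Q : CISys.{u} (Proc S)} (D : Diag (Proc.readout S) P Q) : Prop :=
  ξ.interpret b D = ξ.onSys (A := P.caus) (X := P.inf) (B := Q.caus) (Y := Q.inf) (Quot.mk _ D)

variable {ξ b}

theorem Coincides.comp {P Q T : CISys.{u} (Proc S)} {D : Diag (Proc.readout S) P Q}
    {E : Diag (Proc.readout S) Q T} (hD : ξ.Coincides b D) (hE : ξ.Coincides b E) :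
    ξ.Coincides b (D.comp E) :=
  (congrArg₂ _ hD hE).trans (ξ.onSys_comp _ _).symm

theorem Coincides.par {P Q P' Q' : CISys.{u} (Proc S)} {D : Diag (Proc.readout S) P Q}
    {E : Diag (Proc.readout S) P' Q'} (hD : ξ.Coincides b D) (hE : ξ.Coincides b E) :
    ξ.Coincides b (D.par E) :=
  (congrArg₂ CI.par hD hE).trans (ξ.onSys_par _ _).symm

theorem coincides_id (P : CISys.{u} (Proc S)) : ξ.Coincides b (.id P) := ξ.onSys_id.symm

theorem coincides_infer (A : Proc S) (s : SubStoch X Y) : ξ.Coincides b (Diag.infer A s) :=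
  (ξ.interpret_infer b A s).trans (ξ.onSys_infer A s).symm

theorem coincides_learn (A : Proc S) (h) : ξ.Coincides b (.learn A h) := rfl

theorem coincides_ignore (A : Proc S) : ξ.Coincides b (.ignore A) := (ξ.onSys_ignore A).symm

theorem coincides_leftUnitor (A : Proc S) (s : SubStoch X Y) :
    ξ.Coincides b (.embed (λ_ A).hom s) :=
  (embedRandom_pure _ _).trans (ξ.onSys_leftUnitor A s).symm

theorem Coincides.beside {D : Diag (Proc.readout S) ⟨A, X⟩ ⟨B, Y⟩} (h : ξ.Coincides b D)
    (Z : Type u) : ξ.Coincides b (D.beside Z) :=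
  .comp ((embedRandom_pure _ _).trans (ξ.onSys_rightUnitor_inv A _).symm)
    ((h.par (coincides_id _)).comp
      ((embedRandom_pure _ _).trans (ξ.onSys_rightUnitor B _).symm))

/-- A rule between diagrams on which the interpretation equals `ξ` is inherited from `ξ`. This is
how the rules for learning hold with no knowledge of what `ξ` does to `learn`. -/
theorem Coincides.interpret_eq {P Q : CISys.{u} (Proc S)} {D E : Diag (Proc.readout S) P Q}
    (hD : ξ.Coincides b D) (hE : ξ.Coincides b E) (h : Diag.Rel (Proc.rules S) D E) :
    ξ.interpret b D = ξ.interpret b E :=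
  hD.trans ((congrArg _ (Quot.sound h)).trans hE.symm)

/-- Wiring is sent to certain wiring, so the structural rules are those of the realist theory. The
rules for `embed` and `know` come from compositionality, `know_ignore` also from `hb`. The remaining
rules, for `learn` and `ignore`, are inherited from `ξ`. -/
theorem interpret_eq_of_rel (hb : ∀ t, (b t).mass = 1) {P Q : CISys.{u} (Proc S)}
    {D E : Diag (Proc.readout S) P Q} (h : Diag.Rel (Proc.rules S) D E) :
    ξ.interpret b D = ξ.interpret b E := by
  induction h with
  | extra h => exact h.elim
  | comp_left _ _ h => exact congrArg (· ≫ _) h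
  | comp_right _ _ h => exact congrArg (_ ≫ ·) h
  | par_left _ _ h => exact congrArg (CI.par · _) h
  | par_right _ _ h => exact congrArg (CI.par _ ·) h
  | id_comp => exact Category.id_comp _
  | comp_id => exact Category.comp_id _
  | comp_assoc => exact Category.assoc _ _ _
  | par_id P Q =>
    exact MonoidalCategory.id_tensorHom_id (sys Rules (L.ont P.caus) P.inf)
      (sys Rules (L.ont Q.caus) Q.inf)
  | par_comp => exact par_comp _ _ _ _
  | assoc_natural D E G =>
    exact (congrArg (_ ≫ ·) (embedRandom_pure _ _)).trans ((par_assoc _ _ _).trans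
      (congrArg (· ≫ _) (embedRandom_pure _ _).symm))
  | left_natural D =>
    exact (congrArg (_ ≫ ·) (embedRandom_pure _ _)).trans ((unit_par _).trans
      (congrArg (· ≫ _) (embedRandom_pure _ _).symm))
  | right_natural D =>
    exact (congrArg (_ ≫ ·) (embedRandom_pure _ _)).trans ((par_unit _).trans
      (congrArg (· ≫ _) (embedRandom_pure _ _).symm))
  | swap_natural D E =>
    exact (congrArg (_ ≫ ·) (embedRandom_pure _ _)).trans ((par_swap _ _).trans
      (congrArg (· ≫ _) (embedRandom_pure _ _).symm))
  | embed_id A X => exact (embedRandom_pure _ _).trans (embed_id _ _)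
  | embed_comp t t' s s' =>
    exact (embedRandom_comp _ _ _ _).trans
      (congrArg (embedRandom · _) (ofBoxes_comp b t t').symm)
  | embed_par t s t' s' =>
    exact (embedRandom_par _ _ _ _).trans
      (congrArg (embedRandom · _) (ofBoxes_tensor b t t').symm)
  | embed_know t =>
    exact (point_natural (ofBoxes b) t).symm.trans
      (congrArg (· ≫ _) (ξ.interpret_infer b _ _).symm)
  | know_seq A B F =>
    refine (congrArg₂ _ (ξ.interpret_beside b _ _)
      (congrArg (· ≫ _) (ξ.interpret_infer b _ _))).trans ?_
    exact ((ofBoxes_compositional b).natural_seq A B F).trans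
      (congrArg (· ≫ _) (ξ.interpret_infer b _ _).symm)
  | know_par A B A' B' =>
    exact (congrArg (_ ≫ ·) (ξ.interpret_infer b _ _)).trans
      (((ofBoxes_compositional b).natural_par A B A' B').trans
        (congrArg (· ≫ _) (ξ.interpret_infer b _ _).symm))
  | learn_discard A h =>
    exact ((coincides_learn A h).comp (coincides_infer _ _)).interpret_eq (coincides_id _)
      (.learn_discard A h)
  | learn_learn A h =>
    exact ((coincides_learn A h).comp ((coincides_infer _ _).comp
      ((coincides_learn A h).beside _))).interpret_eq
        ((coincides_learn A h).comp (coincides_infer _ _)) (.learn_learn A h)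
  | learn_par hA hB =>
    exact ((coincides_learn _ _).comp (coincides_infer _ _)).interpret_eq
      ((coincides_infer _ _).comp ((coincides_learn _ hA).par (coincides_learn _ hB)))
      (.learn_par hA hB)
  | ignore_par A B =>
    exact (coincides_ignore _).interpret_eq ((coincides_infer _ _).comp
      (((coincides_ignore A).par (coincides_ignore B)).comp (coincides_leftUnitor _ _)))
      (.ignore_par A B)
  | ignore_unit => exact (coincides_ignore _).interpret_eq (coincides_id _) .ignore_unit
  | know_ignore A B =>
    exact (natural_ignore (ofBoxes_isStochastic b hb) A B).trans
      (congrArg (· ≫ _) (ξ.interpret_infer b _ _).symm)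

/-- The random functions for the primitive procedures agree with their representation by `ξ`. -/
def AgreeOnBoxes (ξ : ClassicalRealistRepresentation p q L)
    (b : ∀ t : S.Procedure, SubDist (L.ont (S.input t) ⟶ L.ont (S.output t))) : Prop :=
  ∀ t, AgreeOnStates
    (ξ.onSys (embed (Proc.rules S) (A := S.input t) (B := S.output t) (Quot.mk _ (.box t))
      (SubStoch.id PUnit)))
    (embedRandom (b t) (SubStoch.id PUnit))

theorem agree_know (hb : AgreeOnBoxes ξ b) (A B : Proc S) :
    AgreeOnStates (ξ.onSys (PS.know A B)) ((ofBoxes b).natural A B) := by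
  obtain ⟨s, hs⟩ := exists_prepare_comp (ξ.onSys (PS.know A B))
  obtain ⟨s', hs'⟩ := exists_prepare_comp ((ofBoxes b).natural A B)
  refine hs.trans (Eq.trans ?_ hs'.symm)
  congr 2
  -- It suffices to compare the two maps at a known state and certain knowledge of `f`. There
  -- `embed_know` turns `know` into the embedded procedure `f`, to which `agree_random` applies.
  funext ⟨a, f⟩
  have h : prepare (L.ont A) PUnit ≫ embed Rules (𝟙 (L.ont A)) (SubStoch.point f) ≫
        ξ.onSys (PS.know A B) =
      prepare (L.ont A) PUnit ≫ embed Rules (𝟙 (L.ont A)) (SubStoch.point f) ≫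
        (ofBoxes b).natural A B := by
    rw [point_natural, ← ξ.onSys_infer, ← onSys_comp, ← embed_know]
    rcases f with ⟨f⟩
    exact ξ.agree_random hb f
  rw [reassoc_of% prepare_embed, reassoc_of% prepare_embed, hs, hs', embed_comp_assoc,
    embed_comp_assoc] at h
  have h' := congrFun (embed_prepare_injective q h) (a, PUnit.unit)
  simp at h'
  exact h'

/-- Both sides are built by the same compositions, so agreement on generators is enough; on `learn`
and `ignore` they are even equal. -/
theorem agree_interpret (hb : AgreeOnBoxes ξ b) {P Q : CISys.{u} (Proc S)}
    (D : Diag (Proc.readout S) P Q) :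
    AgreeOnStates (ξ.onSys (A := P.caus) (X := P.inf) (B := Q.caus) (Y := Q.inf) (Quot.mk _ D))
      (ξ.interpret b D) := by
  induction D with
  | id P => exact congrArg _ ξ.onSys_id
  | @comp P Q T D E hD hE =>
    have h := ξ.onSys_comp (A := P.caus) (X := P.inf) (B := Q.caus) (Y := Q.inf) (F := T.caus)
      (Z := T.inf) (Quot.mk _ D) (Quot.mk _ E)
    exact Eq.trans (congrArg _ h) (hD.comp hE)
  | @par P Q P' Q' D E hD hE =>
    have h := ξ.onSys_par (A := P.caus) (X := P.inf) (B := Q.caus) (Y := Q.inf) (A' := P'.caus)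
      (X' := P'.inf) (B' := Q'.caus) (Y' := Q'.inf) (Quot.mk _ D) (Quot.mk _ E)
    exact Eq.trans (congrArg _ h) (hD.par hE)
  | @embed A B X Y t s =>
    rcases t with ⟨t⟩
    have h := (AgreeOnStates.refl (embed Rules (ρ_ (L.ont A)).inv
      (SubStoch.det (Equiv.punitProd X).symm))).comp
        (((ξ.agree_random hb t).par (.refl (embed Rules (𝟙 _) s))).comp (.refl
          (embed Rules (ρ_ (L.ont B)).hom (SubStoch.det (Equiv.punitProd Y)))))
    exact Eq.trans (congrArg _ (ξ.onSys_embed _ s))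
      (h.trans (congrArg _ (embedRandom_eq_split _ s).symm))
  | know A B => exact agree_know hb A B
  | learn A h => exact .refl _
  | ignore A => exact congrArg _ (ξ.onSys_ignore A)

variable (ξ) in
/-- The representation of natural form given by random functions that agree with `ξ`. -/
def naturalRepresentation (hb : ∀ t, (b t).mass = 1) (hξ : AgreeOnBoxes ξ b) :
    ClassicalRealistRepresentation p q L where
  map := Quot.lift (ξ.interpret b) fun _ _ h => interpret_eq_of_rel hb h
  map_id _ := rfl
  map_comp := by rintro _ _ _ ⟨D⟩ ⟨E⟩; rfl
  map_tensor := by rintro _ _ _ _ ⟨D⟩ ⟨E⟩; rfl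
  map_associator _ _ _ := embedRandom_pure _ _
  map_leftUnitor _ := embedRandom_pure _ _
  map_rightUnitor _ := embedRandom_pure _ _
  map_braiding _ _ := embedRandom_pure _ _
  map_split _ _ := embedRandom_pure _ _
  -- A closed diagram is mapped to a closed process, where agreement with `ξ` is equality.
  map_predictions := by
    rintro X Y ⟨D⟩
    exact (congrArg q.map (agree_interpret hξ D).eq_of_closed).symm.trans (ξ.map_predictions _)
  map_ignore _ := rfl

end ClassicalRealistRepresentation

end

/-- Every classical realist representation is inferentially equivalent to one of the natural form,
in which states of knowledge about procedures are mapped by stochastic maps to states of knowledge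
about functions, which are then fed into the generator for functions. -/
theorem theorem6 (S : ProcSignature.{u}) (p : OperationalPredictions S)
    (q : RealistPredictions.{u}) (L : OnticStates S)
    (ξ : ClassicalRealistRepresentation p q L) :
    ∃ Ξ : KnowledgeMap L,
      (∀ A B : Proc S, (Ξ A B).IsStochastic) ∧
      Ξ.Compositional ∧
      (∀ A B : Proc S, InferentiallyEquivalent q (ξ.map (PS.know A B)) (Ξ.natural A B)) ∧
      ∃ ξ' : ClassicalRealistRepresentation p q L,
        (∀ A B : Proc S, ξ'.map (PS.know A B) = Ξ.natural A B) ∧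
        ∀ (P Q : PS S) (D : P ⟶ Q), InferentiallyEquivalent q (ξ.map D) (ξ'.map D) := by
  -- Random functions are chosen for the primitive procedures only; independent composition
  -- determines all others.
  choose b hb hξ using fun t : S.Procedure =>
    ξ.exists_embedRandom (A := S.input t) (B := S.output t) (Quot.mk _ (.box t))
  refine ⟨KnowledgeMap.ofBoxes b, KnowledgeMap.ofBoxes_isStochastic b hb,
    KnowledgeMap.ofBoxes_compositional b,
    fun A B => (ClassicalRealistRepresentation.agree_know hξ A B).inferentiallyEquivalent q,
    ξ.naturalRepresentation hb hξ, fun _ _ => rfl, ?_⟩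
  rintro P Q ⟨D⟩
  exact (ClassicalRealistRepresentation.agree_interpret hξ D).inferentiallyEquivalent q
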